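/- A Floyd function is a function $f:\mathbb N_{\ge 1}\to\mathbb R_{>0}$ with $\sum_{n\ge 1}f(n)<\infty$ for which there is $\lambda>0$ with $f(n)\ge f(n+1)\ge\lambda f(n)$ for all $n\ge 1$; we put $f(0):=f(1)$. Let $G$ be a group with a finite generating set $S$, let $\Gamma_{G,S}$ be its Cayley graph and $d$ the word metric. Give an edge $\{g,h\}$ of $\Gamma_{G,S}$ the length $f(d(e_G,\{g,h\}))$, and let $d_f(v,w)$ be the infimum of the total lengths of the edge paths joining $v$ and $w$. The Floyd boundary $\partial_f(G,S)$ is the complement of $G$ in the Cauchy completion of $(G,d_f)$ (equivalently, the complement of $\Gamma_{G,S}$ in the completion of the whole rescaled Cayley graph). Proposition. Let $A$ be a finitely generated infinite group, $F$ a non-trivial finite group and $f$ a Floyd function. (i) For every finite generating set $S$ of $A$ and every generating set $T$ of $F$, the Floyd boundary of $A*A$ with respect to the generating set $S\sqcup S$ (one copy of $S$ in each free factor) is homeomorphic to the Floyd boundary of $A*F$ with respect to the generating set $S\sqcup T$. (ii) If moreover there is a constant $D$ with $f(n)\le D\,f(2n)$ for all $n\ge 1$, then $\partial_f(A*A,P)$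 is homeomorphic to $\partial_f(A*F,Q)$ for all finite generating sets $P$ of $A*A$ and $Q$ of $A*F$. -/

import Mathlib

open scoped ENNReal

/-- `f` is a Floyd function: a positive summable function on the positive integers with
`f n ≥ f (n + 1) ≥ l * f n` for some constant `l > 0`, extended to `0` by `f 0 = f 1`. -/
structure IsFloydFunction (f : ℕ → ℝ) : Prop where
  pos : ∀ n, 0 < f n
  zero_eq : f 0 = f 1
  summable : Summable f
  decay : ∃ l : ℝ, 0 < l ∧ ∀ n, 1 ≤ n → f (n + 1) ≤ f n ∧ l * f n ≤ f (n + 1)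

/-- `d(e, {g, h})`: the distance from the identity to the set `{g, h}` in the Cayley graph of `G`
with respect to `S`. -/
noncomputable def cayleyDistOne {G : Type*} [Group G] (S : Set G) (g h : G) : ℕ :=
  min ((SimpleGraph.mulCayley S).dist 1 g) ((SimpleGraph.mulCayley S).dist 1 h)

/-- The Floyd length of an edge path in the Cayley graph: the sum of the rescaled lengths
`f (d(e, {g, h}))` of its consecutive edges `{g, h}`. -/
noncomputable def floydLength (f : ℕ → ℝ) {G : Type*} [Group G] (S : Set G) {v w : G}
    (p : (SimpleGraph.mulCayley S).Walk v w) : ℝ≥0∞ :=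
  (p.darts.map fun d => ENNReal.ofReal (f (cayleyDistOne S d.fst d.snd))).sum

/-- The Floyd distance of two vertices of the Cayley graph: the infimum of the Floyd lengths of
the edge paths joining them. If `S` generates `G`, it is finite. -/
noncomputable def floydEDist (f : ℕ → ℝ) {G : Type*} [Group G] (S : Set G) (v w : G) : ℝ≥0∞ :=
  ⨅ p : (SimpleGraph.mulCayley S).Walk v w, floydLength f S p

theorem floydEDist_self (f : ℕ → ℝ) {G : Type*} [Group G] (S : Set G) (v : G) :
    floydEDist f S v v = 0 :=
  le_antisymm (iInf_le_of_le SimpleGraph.Walk.nil (by simp [floydLength])) bot_le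

theorem floydLength_reverse (f : ℕ → ℝ) {G : Type*} [Group G] (S : Set G) {v w : G}
    (p : (SimpleGraph.mulCayley S).Walk v w) :
    floydLength f S p.reverse = floydLength f S p := by
  simp [floydLength, SimpleGraph.Walk.darts_reverse, List.sum_reverse, Function.comp_def,
    cayleyDistOne, min_comm]

theorem floydEDist_comm (f : ℕ → ℝ) {G : Type*} [Group G] (S : Set G) (v w : G) :
    floydEDist f S v w = floydEDist f S w v := by
  have key : ∀ a b : G, floydEDist f S a b ≤ floydEDist f S b a := fun a b =>
    le_iInf fun p => iInf_le_of_le p.reverse (floydLength_reverse f S p).le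
  exact le_antisymm (key v w) (key w v)

theorem floydEDist_triangle (f : ℕ → ℝ) {G : Type*} [Group G] (S : Set G) (u v w : G) :
    floydEDist f S u w ≤ floydEDist f S u v + floydEDist f S v w := by
  unfold floydEDist
  refine ENNReal.le_iInf_add_iInf fun p q => iInf_le_of_le (p.append q) ?_
  simp [floydLength, SimpleGraph.Walk.darts_append]

/-- The vertex set `G` of the Cayley graph with respect to `S`, with the Floyd metric `d_f`. -/
def FloydSpace (_f : ℕ → ℝ) {G : Type*} [Group G] (_S : Set G) : Type _ := G

noncomputable instance FloydSpace.instPseudoEMetricSpace (f : ℕ → ℝ) {G : Type*} [Group G]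
    (S : Set G) : PseudoEMetricSpace (FloydSpace f S) where
  edist := fun v w => floydEDist f S v w
  edist_self := floydEDist_self f S
  edist_comm := floydEDist_comm f S
  edist_triangle := floydEDist_triangle f S

/-- The Floyd boundary of `G` with respect to the generating set `S`: the points of the Cauchy
completion with respect to the Floyd metric that do not come from the Cayley graph. It suffices to
complete the vertex set: each edge is a compact segment and, as the lengths of the edges tend
to zero, a Cauchy sequence that leaves every finite set of edges stays close to vertices. -/
def floydBoundary (f : ℕ → ℝ) {G : Type*} [Group G] (S : Set G) :
    Set (UniformSpace.Completion (FloydSpace f S)) :=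
  (Set.range ((↑) : FloydSpace f S → UniformSpace.Completion (FloydSpace f S)))ᶜ

/-- The subset `S ∪ T` of the free product `A * B`, for `S ⊆ A` and `T ⊆ B`. -/
def freeProductGenerators {A B : Type*} [Group A] [Group B] (S : Set A) (T : Set B) :
    Set (Monoid.Coprod A B) :=
  (Monoid.Coprod.inl : A →* Monoid.Coprod A B) '' S ∪
    (Monoid.Coprod.inr : B →* Monoid.Coprod A B) '' T

/-! Both groups are tree-like arrangements of copies of `A`. At each vertex of a copy, one further
copy is attached in `A * A`, and finitely many through a coset of `F` in `A * F`. The Floyd metric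
cannot tell these patterns apart, because `A` is infinite and the extra multiplicity can be absorbed
into a relabelling of the letters.

Both vertex sets are labelled by the non-empty words over `A`. In `A * A` the letters give the
syllables of a normal form. In `A * F` every letter but the last stands for a pair `(a, b)` with `b
≠ 1`, that is, for a step to `a` in the current copy and through `b` into a new copy. The bijection
between letters and pairs is chosen so that the letter `c` and the component `a` become Floyd-close
as `c` leaves finite sets (`exists_equiv_floydEDist_lt`). It exists because the Floyd metric is
totally bounded, by Hall's theorem and a Schröder-Bernstein argument.

For both labellings, two elements are close exactly if their words diverge late, or diverge at
letters that are far out and close in `A` (`IsFloydCoding`). Everything behind a vertex `u` lies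
within the tail of `∑ f` from `|u|` on, since norms add along normal forms. Conversely, the
projection to a copy of `A` is Lipschitz and each vertex is isolated (`isFloydCoding_of_branching`).
The criterion involves only `A`, `S` and `f`, so matching equal words is uniformly continuous in
both directions and extends to the completions, which gives (i). Under the doubling condition a
change of finite generating set is bi-Lipschitz for the Floyd metrics, so (ii) reduces to (i). -/

/-! ### Word norms and basic estimates for the Floyd metric. -/

section FloydMetric

variable {G : Type*} [Group G]

/-- The word norm of `g` with respect to `S`. -/
noncomputable def wordNorm (S : Set G) (g : G) : ℕ := (SimpleGraph.mulCayley S).dist 1 g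

theorem wordNorm_one (S : Set G) : wordNorm S 1 = 0 := by simp [wordNorm]

theorem mulCayley_reachable_mul {S : Set G} (x : G) {u v : G}
    (h : (SimpleGraph.mulCayley S).Reachable u v) :
    (SimpleGraph.mulCayley S).Reachable (x * u) (x * v) := by
  obtain ⟨p⟩ := h
  induction p with
  | nil => rfl
  | cons h p ih => exact (SimpleGraph.Adj.reachable (by simpa using h)).trans ih

theorem mulCayley_connected {S : Set G} (hS : Subgroup.closure S = ⊤) :
    (SimpleGraph.mulCayley S).Connected := by
  have key : ∀ g : G, (SimpleGraph.mulCayley S).Reachable 1 g := by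
    intro g
    have hg : g ∈ Subgroup.closure S := hS ▸ Subgroup.mem_top g
    induction hg using Subgroup.closure_induction with
    | mem x hx =>
      by_cases h : x = 1
      · rw [h]
      · exact SimpleGraph.Adj.reachable
          ((SimpleGraph.mulCayley_adj S 1 x).2 ⟨Ne.symm h, Or.inl (by simpa using hx)⟩)
    | one => rfl
    | mul x y _ _ hx hy => exact hx.trans (by simpa using mulCayley_reachable_mul x hy)
    | inv x _ hx => simpa using (mulCayley_reachable_mul x⁻¹ hx).symm
  have : Nonempty G := ⟨1⟩
  exact ⟨fun u v => (key u).symm.trans (key v)⟩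

theorem dist_mul_left_le {S : Set G} (hS : Subgroup.closure S = ⊤) (x u v : G) :
    (SimpleGraph.mulCayley S).dist (x * u) (x * v) ≤ (SimpleGraph.mulCayley S).dist u v := by
  obtain ⟨p, hp⟩ := (mulCayley_connected hS).exists_walk_length_eq_dist u v
  let φ : SimpleGraph.mulCayley S →g SimpleGraph.mulCayley S :=
    ⟨fun g => x * g, fun h => by simpa using h⟩
  rw [← hp, ← SimpleGraph.Walk.length_map φ p]
  exact SimpleGraph.dist_le _

theorem dist_eq_wordNorm {S : Set G} (hS : Subgroup.closure S = ⊤) (u v : G) :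
    (SimpleGraph.mulCayley S).dist u v = wordNorm S (u⁻¹ * v) := by
  apply le_antisymm
  · simpa [wordNorm] using dist_mul_left_le hS u 1 (u⁻¹ * v)
  · simpa [wordNorm] using dist_mul_left_le hS u⁻¹ u v

theorem wordNorm_mul_le {S : Set G} (hS : Subgroup.closure S = ⊤) (u v : G) :
    wordNorm S (u * v) ≤ wordNorm S u + wordNorm S v := by
  have h := (mulCayley_connected hS).dist_triangle (u := 1) (v := u) (w := u * v)
  rwa [dist_eq_wordNorm hS u, inv_mul_cancel_left] at h

theorem wordNorm_inv {S : Set G} (hS : Subgroup.closure S = ⊤) (u : G) :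
    wordNorm S u⁻¹ = wordNorm S u := by
  have := dist_eq_wordNorm hS u 1
  rw [SimpleGraph.dist_comm] at this
  simpa [wordNorm] using this.symm

theorem wordNorm_le_mul_right {S : Set G} (hS : Subgroup.closure S = ⊤) (u v : G) :
    wordNorm S u ≤ wordNorm S (u * v) + wordNorm S v := by
  simpa [wordNorm_inv hS] using wordNorm_mul_le hS (u * v) v⁻¹

theorem wordNorm_le_mul_left {S : Set G} (hS : Subgroup.closure S = ⊤) (u v : G) :
    wordNorm S v ≤ wordNorm S u + wordNorm S (u * v) := by
  simpa [wordNorm_inv hS] using wordNorm_mul_le hS u⁻¹ (u * v)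

theorem wordNorm_eq_zero {S : Set G} (hS : Subgroup.closure S = ⊤) {g : G}
    (h : wordNorm S g = 0) : g = 1 :=
  ((mulCayley_connected hS).dist_eq_zero_iff.1 h).symm

theorem wordNorm_inv_mul_le_one {S : Set G} {u v : G}
    (hS : Subgroup.closure S = ⊤) (h : (SimpleGraph.mulCayley S).Adj u v) :
    wordNorm S (u⁻¹ * v) ≤ 1 := by
  rw [← dist_eq_wordNorm hS, SimpleGraph.dist_eq_one_iff_adj.2 h]

/-- A prefix of a geodesic: every element of norm at least `n` factors geodesically through an
element of norm `n`. -/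
theorem exists_wordNorm_eq {S : Set G} (hS : Subgroup.closure S = ⊤) {g : G} {n : ℕ}
    (h : n ≤ wordNorm S g) :
    ∃ v t, g = v * t ∧ wordNorm S v = n ∧ wordNorm S g = wordNorm S v + wordNorm S t := by
  obtain ⟨p, hp⟩ := (mulCayley_connected hS).exists_walk_length_eq_dist 1 g
  change _ = wordNorm S g at hp
  have h1 : wordNorm S (p.getVert n) ≤ n :=
    (SimpleGraph.dist_le (p.take n)).trans (by simp)
  have h2 : wordNorm S ((p.getVert n)⁻¹ * g) ≤ wordNorm S g - n := by
    rw [← dist_eq_wordNorm hS]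
    exact (SimpleGraph.dist_le (p.drop n)).trans (by simp [hp])
  have h3 := wordNorm_mul_le hS (p.getVert n) ((p.getVert n)⁻¹ * g)
  rw [mul_inv_cancel_left] at h3
  exact ⟨p.getVert n, (p.getVert n)⁻¹ * g, by group, by omega, by omega⟩

theorem finite_wordNorm_le {S : Set G} (hS : Subgroup.closure S = ⊤) (hfin : S.Finite) (n : ℕ) :
    {g | wordNorm S g ≤ n}.Finite := by
  induction n with
  | zero => exact (Set.finite_singleton 1).subset fun g hg => wordNorm_eq_zero hS (by simpa using hg)
  | succ n ih =>
    refine (ih.union (ih.mul (hfin.union hfin.inv))).subset fun g hg => ?_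
    rcases Nat.lt_or_ge n (wordNorm S g) with h | h
    · obtain ⟨v, t, rfl, hv, ht⟩ := exists_wordNorm_eq hS h.le
      refine Or.inr (Set.mul_mem_mul hv.le ?_)
      have ht1 : wordNorm S t = 1 := by
        have : wordNorm S (v * t) ≤ n + 1 := hg
        omega
      have := (SimpleGraph.mulCayley_adj S 1 t).1 (SimpleGraph.dist_eq_one_iff_adj.1 ht1)
      simpa using this.2
    · exact Or.inl h

variable {f : ℕ → ℝ}

theorem IsFloydFunction.antitone (hf : IsFloydFunction f) : Antitone f := by
  obtain ⟨l, _, h⟩ := hf.decay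
  refine antitone_nat_of_succ_le fun n => ?_
  rcases Nat.eq_zero_or_pos n with rfl | hn
  · exact hf.zero_eq.ge
  · exact (h n hn).1

theorem IsFloydFunction.exists_pow_mul_le (hf : IsFloydFunction f) :
    ∃ l : ℝ, 0 < l ∧ l ≤ 1 ∧ ∀ k n, l ^ k * f n ≤ f (n + k) := by
  obtain ⟨l, hl, h⟩ := hf.decay
  have h1 := h 1 le_rfl
  have hl1 : l ≤ 1 := by
    by_contra hc
    have := mul_lt_mul_of_pos_right (not_le.1 hc) (hf.pos 1)
    linarith
  refine ⟨l, hl, hl1, fun k n => ?_⟩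
  induction k with
  | zero => simp
  | succ k ih =>
    have : l * f (n + k) ≤ f (n + k + 1) := by
      rcases Nat.eq_zero_or_pos (n + k) with h0 | h0
      · rw [h0, hf.zero_eq]
        exact mul_le_of_le_one_left (hf.pos 1).le hl1
      · exact (h _ h0).2
    calc l ^ (k + 1) * f n = l * (l ^ k * f n) := by ring
      _ ≤ l * f (n + k) := by gcongr
      _ ≤ _ := this

theorem floydEDist_le_of_adj {S : Set G} {u v : G} (h : (SimpleGraph.mulCayley S).Adj u v) :
    floydEDist f S u v ≤ ENNReal.ofReal (f (cayleyDistOne S u v)) :=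
  iInf_le_of_le h.toWalk (by simp [floydLength, SimpleGraph.Adj.toWalk])

theorem floydLength_cons {S : Set G} {u v w : G} (h : (SimpleGraph.mulCayley S).Adj u v)
    (p : (SimpleGraph.mulCayley S).Walk v w) :
    floydLength f S (p.cons h) = ENNReal.ofReal (f (cayleyDistOne S u v)) + floydLength f S p := by
  simp [floydLength]

/-- A pseudometric that is controlled on edges is controlled by the Floyd metric. -/
theorem le_mul_floydEDist {S : Set G} {D : G → G → ℝ≥0∞} (hD0 : ∀ g, D g g = 0)
    (hD : ∀ u v w, D u w ≤ D u v + D v w) {C : ℝ≥0∞} (hC0 : C ≠ 0) (hC : C ≠ ∞)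
    (h : ∀ u v, (SimpleGraph.mulCayley S).Adj u v →
      D u v ≤ C * ENNReal.ofReal (f (cayleyDistOne S u v))) (u v : G) :
    D u v ≤ C * floydEDist f S u v := by
  rw [floydEDist, ENNReal.mul_iInf_of_ne hC0 hC]
  refine le_iInf fun p => ?_
  induction p with
  | nil => simp [hD0]
  | cons hadj p ih =>
    rw [floydLength_cons, mul_add]
    exact (hD _ _ _).trans (add_le_add (h _ _ hadj) ih)

/-- The first edge of a path leaving `u` already has at least this length, as `f` is antitone. Hence
each vertex is isolated, with a radius that depends only on its norm. -/
theorem le_floydEDist_of_ne (hf : IsFloydFunction f) {S : Set G} {u v : G} (h : u ≠ v) :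
    ENNReal.ofReal (f (wordNorm S u)) ≤ floydEDist f S u v := by
  refine le_iInf fun p => ?_
  cases p with
  | nil => exact absurd rfl h
  | cons hadj p =>
    rw [floydLength_cons]
    exact le_add_right (ENNReal.ofReal_le_ofReal (hf.antitone (min_le_left _ _)))

/-- The tail of the series of `f`. -/
noncomputable def floydTail (f : ℕ → ℝ) (n : ℕ) : ℝ≥0∞ := ∑' k, ENNReal.ofReal (f (k + n))

theorem floydTail_succ (f : ℕ → ℝ) (n : ℕ) :
    floydTail f n = ENNReal.ofReal (f n) + floydTail f (n + 1) := by
  rw [floydTail, tsum_eq_zero_add' ENNReal.summable]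
  simp [floydTail, add_assoc, add_comm 1]

theorem tendsto_floydTail (hf : IsFloydFunction f) :
    Filter.Tendsto (floydTail f) Filter.atTop (nhds 0) :=
  ENNReal.tendsto_sum_nat_add (fun k => ENNReal.ofReal (f k)) hf.summable.tsum_ofReal_ne_top

theorem exists_floydTail_lt (hf : IsFloydFunction f) {ε : ℝ≥0∞} (hε : 0 < ε) :
    ∃ N, ∀ n, N ≤ n → floydTail f n < ε :=
  Filter.eventually_atTop.1 ((tendsto_floydTail hf).eventually_lt_const hε)

/-- By the triangle inequality at the endpoint `w`, the vertex reached after `i` steps has norm at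
least `k + i`, so the edge that follows has length at most `f (k + i)`. -/
theorem floydLength_le_floydTail (hf : IsFloydFunction f) {S : Set G}
    (hS : Subgroup.closure S = ⊤) {v w : G}
    (p : (SimpleGraph.mulCayley S).Walk v w) (k : ℕ) (h : k + p.length ≤ wordNorm S w) :
    floydLength f S p ≤ floydTail f k := by
  induction p generalizing k with
  | nil => simp [floydLength]
  | cons hadj p ih =>
    rw [floydLength_cons, floydTail_succ]
    rw [SimpleGraph.Walk.length_cons] at h
    refine add_le_add (ENNReal.ofReal_le_ofReal (hf.antitone (le_min ?_ ?_))) (ih _ (by omega))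
    · have := SimpleGraph.dist_le (p.cons hadj)
      rw [SimpleGraph.Walk.length_cons] at this
      have h2 := (mulCayley_connected hS).dist_triangle (u := 1) (v := _) (w := _) |>.trans
        (Nat.add_le_add_left this _)
      unfold wordNorm at h
      omega
    · have h2 := (mulCayley_connected hS).dist_triangle (u := 1) (v := _) (w := _) |>.trans
        (Nat.add_le_add_left (SimpleGraph.dist_le p) _)
      unfold wordNorm at h
      omega

/-- Along a geodesic through `u`, the Floyd distance to `u` is at most the tail from `|u|` on. -/
theorem floydEDist_mul_le_floydTail (hf : IsFloydFunction f) {S : Set G}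
    (hS : Subgroup.closure S = ⊤) {u t : G}
    (h : wordNorm S (u * t) = wordNorm S u + wordNorm S t) :
    floydEDist f S u (u * t) ≤ floydTail f (wordNorm S u) := by
  obtain ⟨p, hp⟩ := (mulCayley_connected hS).exists_walk_length_eq_dist u (u * t)
  rw [dist_eq_wordNorm hS, inv_mul_cancel_left] at hp
  exact iInf_le_of_le p (floydLength_le_floydTail hf hS p _ (by omega))

/-- Translation by `x` changes norms by at most `|x|`, so the decay bound on `f` lets edge lengths
grow at most by the factor `l⁻¹ ^ |x|`. -/
theorem floydEDist_mul_left_le (hf : IsFloydFunction f) {S : Set G}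
    (hS : Subgroup.closure S = ⊤) (x : G) :
    ∃ C : ℝ≥0∞, C ≠ 0 ∧ C ≠ ∞ ∧
      ∀ u v, floydEDist f S (x * u) (x * v) ≤ C * floydEDist f S u v := by
  obtain ⟨l, hl, hl1, hle⟩ := hf.exists_pow_mul_le
  set k := wordNorm S x
  have hpos : 0 < (l ^ k)⁻¹ := by positivity
  refine ⟨ENNReal.ofReal (l ^ k)⁻¹, by simpa using pow_pos hl k, ENNReal.ofReal_ne_top, ?_⟩
  refine le_mul_floydEDist (D := fun u v => floydEDist f S (x * u) (x * v))
    (fun g => floydEDist_self _ _ _) (fun u v w => floydEDist_triangle _ _ _ _ _)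
    (by simpa using pow_pos hl k) ENNReal.ofReal_ne_top fun u v hadj => ?_
  refine (floydEDist_le_of_adj (by simpa using hadj)).trans ?_
  rw [← ENNReal.ofReal_mul hpos.le]
  refine ENNReal.ofReal_le_ofReal ?_
  rw [le_inv_mul_iff₀ (by positivity)]
  refine (hle k _).trans (hf.antitone ?_)
  have h1 := wordNorm_le_mul_left hS x u
  have h2 := wordNorm_le_mul_left hS x v
  simp only [cayleyDistOne]
  change min (wordNorm S u) (wordNorm S v) ≤ min (wordNorm S (x * u)) (wordNorm S (x * v)) + k
  omega

/-- A map that sends each edge to a vertex, or to an edge without decreasing norms, is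
1-Lipschitz for the Floyd metrics. -/
theorem floydEDist_map_le {H : Type*} [Group H] (hf : IsFloydFunction f) {S : Set G} {T : Set H}
    (φ : G → H) (h : ∀ u v, (SimpleGraph.mulCayley S).Adj u v →
      φ u = φ v ∨ ((SimpleGraph.mulCayley T).Adj (φ u) (φ v) ∧ wordNorm S u ≤ wordNorm T (φ u) ∧
        wordNorm S v ≤ wordNorm T (φ v))) (u v : G) :
    floydEDist f T (φ u) (φ v) ≤ floydEDist f S u v := by
  rw [← one_mul (floydEDist f S u v)]
  refine le_mul_floydEDist (D := fun u v => floydEDist f T (φ u) (φ v))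
    (fun g => floydEDist_self _ _ _) (fun u v w => floydEDist_triangle _ _ _ _ _)
    one_ne_zero ENNReal.one_ne_top (fun u v hadj => ?_) u v
  rcases h u v hadj with h | ⟨h1, h2, h3⟩
  · simp [h, floydEDist_self]
  · rw [one_mul]
    exact (floydEDist_le_of_adj h1).trans
      (ENNReal.ofReal_le_ofReal (hf.antitone (min_le_min h2 h3)))

/-- The Floyd metric is totally bounded: all but finitely many elements are close to a fixed
finite ball. -/
theorem exists_finite_floydEDist_lt (hf : IsFloydFunction f) {S : Set G}
    (hS : Subgroup.closure S = ⊤) (hfin : S.Finite) {ε : ℝ≥0∞} (hε : 0 < ε) :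
    ∃ B : Set G, B.Finite ∧ ∀ g, ∃ b ∈ B, floydEDist f S b g < ε := by
  obtain ⟨N, hN⟩ := exists_floydTail_lt hf hε
  refine ⟨_, finite_wordNorm_le hS hfin N, fun g => ?_⟩
  rcases le_total (wordNorm S g) N with h | h
  · exact ⟨g, h, by simpa [floydEDist_self] using hε⟩
  · obtain ⟨v, t, rfl, hv, ht⟩ := exists_wordNorm_eq hS h
    exact ⟨v, hv.le, (floydEDist_mul_le_floydTail hf hS ht).trans_lt (hN _ hv.ge)⟩

end FloydMetric

/-! ### Normal forms and first letters in a free product. -/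

section FreeProduct

open Monoid

universe u v

variable {A : Type u} {B : Type v} [Group A] [Group B]

/-- The factors of a free product, in a common universe. -/
def CoprodFactor (A : Type u) (B : Type v) : Bool → Type (max u v)
  | false => ULift A
  | true => ULift B

instance CoprodFactor.instGroup : ∀ b, Group (CoprodFactor A B b)
  | false => inferInstanceAs (Group (ULift A))
  | true => inferInstanceAs (Group (ULift B))

/-- The left factor as a member of the family `CoprodFactor A B`. -/
def CoprodFactor.equivLeft : A ≃* CoprodFactor A B false := MulEquiv.ulift.symm

/-- The right factor as a member of the family `CoprodFactor A B`. -/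
def CoprodFactor.equivRight : B ≃* CoprodFactor A B true := MulEquiv.ulift.symm

noncomputable instance (b : Bool) : DecidableEq (CoprodFactor A B b) := Classical.decEq _

/-- The comparison of the binary with the indexed free product. -/
def coprodToCoprodI : Coprod A B →* CoprodI (CoprodFactor A B) :=
  Coprod.lift (CoprodI.of.comp CoprodFactor.equivLeft.toMonoidHom)
    (CoprodI.of.comp CoprodFactor.equivRight.toMonoidHom)

/-- The normal form of an element of a free product. -/
noncomputable def coprodWord (g : Coprod A B) : CoprodI.Word (CoprodFactor A B) :=
  coprodToCoprodI g • CoprodI.Word.empty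

/-- The first letter of the normal form if it belongs to the left factor, and `1` otherwise. -/
noncomputable def projl (g : Coprod A B) : A :=
  CoprodFactor.equivLeft.symm (CoprodI.Word.equivPair false (coprodWord g)).head

/-- The first letter of the normal form if it belongs to the right factor, and `1` otherwise. -/
noncomputable def projr (g : Coprod A B) : B :=
  CoprodFactor.equivRight.symm (CoprodI.Word.equivPair true (coprodWord g)).head

theorem projl_inl_mul (a : A) (g : Coprod A B) : projl (Coprod.inl a * g) = a * projl g := by
  have h : coprodToCoprodI (Coprod.inl a : Coprod A B) =
    CoprodI.of (CoprodFactor.equivLeft a) := rfl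
  rw [projl, coprodWord, map_mul, mul_smul, h, CoprodI.Word.of_smul_def,
    ← CoprodI.Word.equivPair_symm, Equiv.apply_symm_apply, map_mul, MulEquiv.symm_apply_apply]
  rfl

theorem projr_inr_mul (b : B) (g : Coprod A B) : projr (Coprod.inr b * g) = b * projr g := by
  have h : coprodToCoprodI (Coprod.inr b : Coprod A B) =
    CoprodI.of (CoprodFactor.equivRight b) := rfl
  rw [projr, coprodWord, map_mul, mul_smul, h, CoprodI.Word.of_smul_def,
    ← CoprodI.Word.equivPair_symm, Equiv.apply_symm_apply, map_mul, MulEquiv.symm_apply_apply]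
  rfl

theorem projl_eq_one_or (g : Coprod A B) : projl g = 1 ∨ projr g = 1 := by
  by_cases h : (coprodWord g).fstIdx = some false
  · right
    rw [projr, CoprodI.Word.equivPair_eq_of_fstIdx_ne (by rw [h]; decide), map_one]
  · left
    rw [projl, CoprodI.Word.equivPair_eq_of_fstIdx_ne h, map_one]

theorem projl_one : projl (1 : Coprod A B) = 1 := by
  rw [projl, coprodWord, map_one, one_smul, CoprodI.Word.equivPair_eq_of_fstIdx_ne
    (by simp [CoprodI.Word.fstIdx, CoprodI.Word.empty]), map_one]

theorem projr_one : projr (1 : Coprod A B) = 1 := by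
  rw [projr, coprodWord, map_one, one_smul, CoprodI.Word.equivPair_eq_of_fstIdx_ne
    (by simp [CoprodI.Word.fstIdx, CoprodI.Word.empty]), map_one]

theorem projl_inl (a : A) : projl (Coprod.inl a : Coprod A B) = a := by
  simpa [projl_one] using projl_inl_mul a (1 : Coprod A B)

theorem projr_inr (b : B) : projr (Coprod.inr b : Coprod A B) = b := by
  simpa [projr_one] using projr_inr_mul b (1 : Coprod A B)

theorem projr_inl_mul {a : A} {t : Coprod A B} (ha : a ≠ 1) (ht : projl t = 1) :
    projr (Coprod.inl a * t) = 1 :=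
  (projl_eq_one_or _).resolve_left (by simpa [projl_inl_mul, ht] using ha)

theorem projl_inr_mul {b : B} {t : Coprod A B} (hb : b ≠ 1) (ht : projr t = 1) :
    projl (Coprod.inr b * t) = 1 :=
  (projl_eq_one_or _).resolve_right (by simpa [projr_inr_mul, ht] using hb)

theorem projr_inl (a : A) : projr (Coprod.inl a : Coprod A B) = 1 := by
  by_cases ha : a = 1
  · simp [ha, projr_one]
  · simpa using projr_inl_mul ha (projl_one (A := A) (B := B))

theorem projl_inr (b : B) : projl (Coprod.inr b : Coprod A B) = 1 := by
  by_cases hb : b = 1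
  · simp [hb, projl_one]
  · simpa using projl_inr_mul hb (projr_one (A := A) (B := B))

/-- The elements of a free product that are built up by adding letters on the left. -/
inductive CoprodNormal : Coprod A B → Prop
  | one : CoprodNormal 1
  | left (a t) : a ≠ 1 → projl t = 1 → CoprodNormal t → CoprodNormal (Coprod.inl a * t)
  | right (b t) : b ≠ 1 → projr t = 1 → CoprodNormal t → CoprodNormal (Coprod.inr b * t)

theorem CoprodNormal.inl_mul (a : A) {g : Coprod A B} (hg : CoprodNormal g) :
    CoprodNormal (Coprod.inl a * g) := by
  by_cases ha : a = 1
  · simpa [ha] using hg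
  cases hg with
  | one => exact .left a 1 ha projl_one .one
  | left a' t ha' ht h =>
    by_cases h1 : a * a' = 1
    · simpa [← mul_assoc, ← map_mul, h1] using h
    · simpa [mul_assoc] using CoprodNormal.left (a * a') t h1 ht h
  | right b t hb ht h => exact .left a _ ha (projl_inr_mul hb ht) (.right b t hb ht h)

theorem CoprodNormal.inr_mul (b : B) {g : Coprod A B} (hg : CoprodNormal g) :
    CoprodNormal (Coprod.inr b * g) := by
  by_cases hb : b = 1
  · simpa [hb] using hg
  cases hg with
  | one => exact .right b 1 hb projr_one .one
  | right b' t hb' ht h =>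
    by_cases h1 : b * b' = 1
    · simpa [← mul_assoc, ← map_mul, h1] using h
    · simpa [mul_assoc] using CoprodNormal.right (b * b') t h1 ht h
  | left a t ha ht h => exact .right b _ hb (projr_inl_mul ha ht) (.left a t ha ht h)

theorem coprodNormal (g : Coprod A B) : CoprodNormal g := by
  induction g using Coprod.induction_on' with
  | one => exact .one
  | inl_mul a g ih => exact ih.inl_mul a
  | inr_mul b g ih => exact ih.inr_mul b

theorem eq_one_of_projl_of_projr {g : Coprod A B} (hl : projl g = 1) (hr : projr g = 1) :
    g = 1 := by
  cases coprodNormal g with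
  | one => rfl
  | left a t ha ht _ => exact absurd (by simpa [projl_inl_mul, ht] using hl) ha
  | right b t hb ht _ => exact absurd (by simpa [projr_inr_mul, ht] using hr) hb

/-- Multiplying on the right by an element of the left factor changes the first letter only if
there is at most one letter. -/
theorem proj_mul_inl (s : A) (g : Coprod A B) :
    (projl (g * Coprod.inl s) = projl g ∨ ∃ a, g = Coprod.inl a) ∧
      projr (g * Coprod.inl s) = projr g := by
  induction coprodNormal g with
  | one => exact ⟨Or.inr ⟨1, by simp⟩, by simp [projr_inl, projr_one]⟩
  | left a t ha ht _ ih =>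
    obtain ⟨h1 | ⟨a', rfl⟩, -⟩ := ih
    · rw [mul_assoc, projr_inl_mul ha ht, projr_inl_mul ha (h1.trans ht), projl_inl_mul,
        projl_inl_mul, h1]
      simp
    · rw [← map_mul, ← map_mul]
      exact ⟨Or.inr ⟨_, rfl⟩, by rw [projr_inl, projr_inl]⟩
  | right b t hb ht _ ih =>
    rw [mul_assoc, projr_inr_mul, projr_inr_mul, ih.2, projl_inr_mul hb ht,
      projl_inr_mul hb (ih.2.trans ht)]
    simp

theorem proj_mul_inr (s : B) (g : Coprod A B) :
    (projr (g * Coprod.inr s) = projr g ∨ ∃ b, g = Coprod.inr b) ∧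
      projl (g * Coprod.inr s) = projl g := by
  induction coprodNormal g with
  | one => exact ⟨Or.inr ⟨1, by simp⟩, by simp [projl_inr, projl_one]⟩
  | right b t hb ht _ ih =>
    obtain ⟨h1 | ⟨b', rfl⟩, -⟩ := ih
    · rw [mul_assoc, projl_inr_mul hb ht, projl_inr_mul hb (h1.trans ht), projr_inr_mul,
        projr_inr_mul, h1]
      simp
    · rw [← map_mul, ← map_mul]
      exact ⟨Or.inr ⟨_, rfl⟩, by rw [projl_inr, projl_inr]⟩
  | left a t ha ht _ ih =>
    rw [mul_assoc, projl_inl_mul, projl_inl_mul, ih.2, projr_inl_mul ha ht,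
      projr_inl_mul ha (ih.2.trans ht)]
    simp

end FreeProduct

/-! ### Cayley graphs of free products: projections to the factors and additivity of norms. -/

section FreeProductMetric

open Monoid

universe u v

variable {A : Type u} {B : Type v} [Group A] [Group B]

theorem closure_freeProductGenerators {S : Set A} {T : Set B} (hS : Subgroup.closure S = ⊤)
    (hT : Subgroup.closure T = ⊤) : Subgroup.closure (freeProductGenerators S T) = ⊤ := by
  rw [freeProductGenerators, Subgroup.closure_union, ← MonoidHom.map_closure,
    ← MonoidHom.map_closure, hS, hT, ← MonoidHom.range_eq_map, ← MonoidHom.range_eq_map,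
    Coprod.range_inl_sup_range_inr]

theorem finite_freeProductGenerators {S : Set A} {T : Set B} (hS : S.Finite) (hT : T.Finite) :
    (freeProductGenerators S T).Finite := (hS.image _).union (hT.image _)

theorem dist_map_le {V W : Type*} {G : SimpleGraph V} (hG : G.Connected) {H : SimpleGraph W}
    {φ : V → W} (h : ∀ u v, G.Adj u v → φ u = φ v ∨ H.Adj (φ u) (φ v)) (u v : V) :
    H.dist (φ u) (φ v) ≤ G.dist u v := by
  have key : ∀ {u v : V} (p : G.Walk u v), ∃ q : H.Walk (φ u) (φ v), q.length ≤ p.length := by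
    intro u v p
    induction p with
    | nil => exact ⟨.nil, le_rfl⟩
    | cons hadj p ih =>
      obtain ⟨q, hq⟩ := ih
      rcases h _ _ hadj with h1 | h1
      · exact ⟨q.copy h1.symm rfl, by simpa using hq.trans (Nat.le_succ _)⟩
      · exact ⟨q.cons h1, by simpa using hq⟩
  obtain ⟨p, hp⟩ := hG.exists_walk_length_eq_dist u v
  obtain ⟨q, hq⟩ := key p
  exact (SimpleGraph.dist_le q).trans (hq.trans hp.le)

/-- Right multiplication by a generator alters the first letter only within the factor itself. So
`projl` collapses every edge outside the copy of `A` and is a retraction of graphs onto that copy.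
-/
theorem adj_freeProductGenerators_projl {S : Set A} {T : Set B} {u v : Coprod A B}
    (h : (SimpleGraph.mulCayley (freeProductGenerators S T)).Adj u v) :
    projl u = projl v ∨
      ∃ a a', u = Coprod.inl a ∧ v = Coprod.inl a' ∧ (SimpleGraph.mulCayley S).Adj a a' := by
  wlog huv : ∃ g ∈ freeProductGenerators S T, u * g = v generalizing u v
  · obtain ⟨hne, g, hg, h1 | h1⟩ := (SimpleGraph.mulCayley_adj' _ _ _).1 h
    · exact absurd ⟨g, hg, h1⟩ huv
    · rcases this h.symm ⟨g, hg, h1.symm⟩ with h2 | ⟨a, a', rfl, rfl, h2⟩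
      · exact Or.inl h2.symm
      · exact Or.inr ⟨a', a, rfl, rfl, h2.symm⟩
  obtain ⟨_, ⟨s, hs, rfl⟩ | ⟨t, ht, rfl⟩, rfl⟩ := huv
  · rcases (proj_mul_inl s u).1 with h1 | ⟨a, rfl⟩
    · exact Or.inl h1.symm
    · refine Or.inr ⟨a, a * s, rfl, by simp, (SimpleGraph.mulCayley_adj' _ _ _).2
        ⟨fun h0 => h.ne ?_, s, hs, Or.inl rfl⟩⟩
      rw [← map_mul, ← h0]
  · exact Or.inl (proj_mul_inr t u).2.symm

theorem mulCayley_adj_inl {S : Set A} {T : Set B} {a a' : A}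
    (h : (SimpleGraph.mulCayley S).Adj a a') :
    (SimpleGraph.mulCayley (freeProductGenerators S T)).Adj (Coprod.inl a) (Coprod.inl a') := by
  obtain ⟨hne, s, hs, h1⟩ := (SimpleGraph.mulCayley_adj' _ _ _).1 h
  refine (SimpleGraph.mulCayley_adj' _ _ _).2 ⟨fun h0 => hne (Coprod.inl_injective h0),
    Coprod.inl s, Or.inl ⟨s, hs, rfl⟩, ?_⟩
  simpa only [← map_mul, Coprod.inl_injective.eq_iff] using h1

theorem wordNorm_inl {S : Set A} {T : Set B} (hS : Subgroup.closure S = ⊤)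
    (hT : Subgroup.closure T = ⊤) (a : A) :
    wordNorm (freeProductGenerators S T) (Coprod.inl a) = wordNorm S a := by
  apply le_antisymm
  · have := dist_map_le (mulCayley_connected hS)
      (H := SimpleGraph.mulCayley (freeProductGenerators S T)) (φ := fun x => Coprod.inl x)
      (fun u v h => Or.inr (mulCayley_adj_inl h)) 1 a
    simpa [wordNorm] using this
  · have := dist_map_le (mulCayley_connected (closure_freeProductGenerators hS hT))
      (H := SimpleGraph.mulCayley S) (φ := projl) (fun u v h => by
        rcases adj_freeProductGenerators_projl h with h' | ⟨a, a', rfl, rfl, h'⟩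
        · exact Or.inl h'
        · exact Or.inr (by simpa only [projl_inl] using h')) 1 (Coprod.inl a)
    simpa [wordNorm, projl_one, projl_inl] using this

/-- Since `projl` changes only along edges of the copy of `A`, a path can acquire its final value
only at the vertex of the copy with that value, which is a cut vertex. -/
theorem inl_projl_mem_support {S : Set A} {T : Set B} {u v : Coprod A B}
    (p : (SimpleGraph.mulCayley (freeProductGenerators S T)).Walk u v) (h : projl u ≠ projl v) :
    Coprod.inl (projl v) ∈ p.support := by
  induction p with
  | nil => exact absurd rfl h
  | @cons u w v hadj p ih =>
    rw [SimpleGraph.Walk.support_cons]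
    refine List.mem_cons_of_mem _ ?_
    by_cases hw : projl w = projl v
    · rcases adj_freeProductGenerators_projl hadj with h1 | ⟨a, a', rfl, rfl, -⟩
      · exact absurd (h1.trans hw) h
      · rw [← hw, projl_inl]
        exact p.start_mem_support
    · exact ih hw

/-- Norms add up along normal forms. -/
theorem wordNorm_inl_mul {S : Set A} {T : Set B} (hS : Subgroup.closure S = ⊤)
    (hT : Subgroup.closure T = ⊤) (a : A) {t : Coprod A B} (ht : projl t = 1) :
    wordNorm (freeProductGenerators S T) (Coprod.inl a * t) =
      wordNorm S a + wordNorm (freeProductGenerators S T) t := by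
  have hR := closure_freeProductGenerators hS hT
  rw [← wordNorm_inl hS hT]
  refine le_antisymm (wordNorm_mul_le hR _ _) ?_
  by_cases ha : a = 1
  · simp [ha, wordNorm_one]
  obtain ⟨p, hp⟩ := (mulCayley_connected hR).exists_walk_length_eq_dist 1 (Coprod.inl a * t)
  -- The geodesic to `a * t` passes through the cut vertex `a`; splitting it there gives the lower
  -- bound.
  have hmem := inl_projl_mem_support p (by simpa [projl_inl_mul, ht, projl_one] using Ne.symm ha)
  rw [projl_inl_mul, ht, mul_one] at hmem
  obtain ⟨q, r, rfl⟩ := SimpleGraph.Walk.mem_support_iff_exists_append.1 hmem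
  rw [SimpleGraph.Walk.length_append] at hp
  have h1 := SimpleGraph.dist_le q
  have h2 := SimpleGraph.dist_le r
  rw [dist_eq_wordNorm hR, inv_mul_cancel_left] at h2
  unfold wordNorm at *
  omega

theorem floydEDist_projl_le {f : ℕ → ℝ} (hf : IsFloydFunction f) {S : Set A} {T : Set B}
    (hS : Subgroup.closure S = ⊤) (hT : Subgroup.closure T = ⊤) (u v : Coprod A B) :
    floydEDist f S (projl u) (projl v) ≤ floydEDist f (freeProductGenerators S T) u v := by
  refine floydEDist_map_le hf projl (fun u v h => ?_) u v
  rcases adj_freeProductGenerators_projl h with h' | ⟨a, a', rfl, rfl, h'⟩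
  · exact Or.inl h'
  · simp only [projl_inl, wordNorm_inl hS hT]
    exact Or.inr ⟨h', le_rfl, le_rfl⟩

theorem floydEDist_inl_le {f : ℕ → ℝ} (hf : IsFloydFunction f) {S : Set A} {T : Set B}
    (hS : Subgroup.closure S = ⊤) (hT : Subgroup.closure T = ⊤) (a a' : A) :
    floydEDist f (freeProductGenerators S T) (Coprod.inl a) (Coprod.inl a') ≤
      floydEDist f S a a' :=
  floydEDist_map_le hf (fun x => (Coprod.inl x : Coprod A B)) (fun _ _ h =>
    Or.inr ⟨mulCayley_adj_inl h, (wordNorm_inl hS hT _).ge, (wordNorm_inl hS hT _).ge⟩) a a'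

theorem adj_freeProductGenerators_projr {S : Set A} {T : Set B} {u v : Coprod A B}
    (h : (SimpleGraph.mulCayley (freeProductGenerators S T)).Adj u v) :
    projr u = projr v ∨
      ∃ b b', u = Coprod.inr b ∧ v = Coprod.inr b' ∧ (SimpleGraph.mulCayley T).Adj b b' := by
  wlog huv : ∃ g ∈ freeProductGenerators S T, u * g = v generalizing u v
  · obtain ⟨hne, g, hg, h1 | h1⟩ := (SimpleGraph.mulCayley_adj' _ _ _).1 h
    · exact absurd ⟨g, hg, h1⟩ huv
    · rcases this h.symm ⟨g, hg, h1.symm⟩ with h2 | ⟨b, b', rfl, rfl, h2⟩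
      · exact Or.inl h2.symm
      · exact Or.inr ⟨b', b, rfl, rfl, h2.symm⟩
  obtain ⟨_, ⟨s, hs, rfl⟩ | ⟨t, ht, rfl⟩, rfl⟩ := huv
  · exact Or.inl (proj_mul_inl s u).2.symm
  · rcases (proj_mul_inr t u).1 with h1 | ⟨b, rfl⟩
    · exact Or.inl h1.symm
    · refine Or.inr ⟨b, b * t, rfl, by simp, (SimpleGraph.mulCayley_adj' _ _ _).2
        ⟨fun h0 => h.ne ?_, t, ht, Or.inl rfl⟩⟩
      rw [← map_mul, ← h0]

theorem mulCayley_adj_inr {S : Set A} {T : Set B} {b b' : B}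
    (h : (SimpleGraph.mulCayley T).Adj b b') :
    (SimpleGraph.mulCayley (freeProductGenerators S T)).Adj (Coprod.inr b) (Coprod.inr b') := by
  obtain ⟨hne, s, hs, h1⟩ := (SimpleGraph.mulCayley_adj' _ _ _).1 h
  refine (SimpleGraph.mulCayley_adj' _ _ _).2 ⟨fun h0 => hne (Coprod.inr_injective h0),
    Coprod.inr s, Or.inr ⟨s, hs, rfl⟩, ?_⟩
  simpa only [← map_mul, Coprod.inr_injective.eq_iff] using h1

theorem wordNorm_inr {S : Set A} {T : Set B} (hS : Subgroup.closure S = ⊤)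
    (hT : Subgroup.closure T = ⊤) (b : B) :
    wordNorm (freeProductGenerators S T) (Coprod.inr b) = wordNorm T b := by
  apply le_antisymm
  · have := dist_map_le (mulCayley_connected hT)
      (H := SimpleGraph.mulCayley (freeProductGenerators S T)) (φ := fun x => Coprod.inr x)
      (fun u v h => Or.inr (mulCayley_adj_inr h)) 1 b
    simpa [wordNorm] using this
  · have := dist_map_le (mulCayley_connected (closure_freeProductGenerators hS hT))
      (H := SimpleGraph.mulCayley T) (φ := projr) (fun u v h => by
        rcases adj_freeProductGenerators_projr h with h' | ⟨b, b', rfl, rfl, h'⟩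
        · exact Or.inl h'
        · exact Or.inr (by simpa only [projr_inr] using h')) 1 (Coprod.inr b)
    simpa [wordNorm, projr_one, projr_inr] using this

theorem inr_projr_mem_support {S : Set A} {T : Set B} {u v : Coprod A B}
    (p : (SimpleGraph.mulCayley (freeProductGenerators S T)).Walk u v) (h : projr u ≠ projr v) :
    Coprod.inr (projr v) ∈ p.support := by
  induction p with
  | nil => exact absurd rfl h
  | @cons u w v hadj p ih =>
    rw [SimpleGraph.Walk.support_cons]
    refine List.mem_cons_of_mem _ ?_
    by_cases hw : projr w = projr v
    · rcases adj_freeProductGenerators_projr hadj with h1 | ⟨b, b', rfl, rfl, -⟩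
      · exact absurd (h1.trans hw) h
      · rw [← hw, projr_inr]
        exact p.start_mem_support
    · exact ih hw

theorem wordNorm_inr_mul {S : Set A} {T : Set B} (hS : Subgroup.closure S = ⊤)
    (hT : Subgroup.closure T = ⊤) (b : B) {t : Coprod A B} (ht : projr t = 1) :
    wordNorm (freeProductGenerators S T) (Coprod.inr b * t) =
      wordNorm T b + wordNorm (freeProductGenerators S T) t := by
  have hR := closure_freeProductGenerators hS hT
  rw [← wordNorm_inr hS hT]
  refine le_antisymm (wordNorm_mul_le hR _ _) ?_
  by_cases hb : b = 1
  · simp [hb, wordNorm_one]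
  obtain ⟨p, hp⟩ := (mulCayley_connected hR).exists_walk_length_eq_dist 1 (Coprod.inr b * t)
  have hmem := inr_projr_mem_support p (by simpa [projr_inr_mul, ht, projr_one] using Ne.symm hb)
  rw [projr_inr_mul, ht, mul_one] at hmem
  obtain ⟨q, r, rfl⟩ := SimpleGraph.Walk.mem_support_iff_exists_append.1 hmem
  rw [SimpleGraph.Walk.length_append] at hp
  have h1 := SimpleGraph.dist_le q
  have h2 := SimpleGraph.dist_le r
  rw [dist_eq_wordNorm hR, inv_mul_cancel_left] at h2
  unfold wordNorm at *
  omega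

theorem floydEDist_projr_le {f : ℕ → ℝ} (hf : IsFloydFunction f) {S : Set A} {T : Set B}
    (hS : Subgroup.closure S = ⊤) (hT : Subgroup.closure T = ⊤) (u v : Coprod A B) :
    floydEDist f T (projr u) (projr v) ≤ floydEDist f (freeProductGenerators S T) u v := by
  refine floydEDist_map_le hf projr (fun u v h => ?_) u v
  rcases adj_freeProductGenerators_projr h with h' | ⟨b, b', rfl, rfl, h'⟩
  · exact Or.inl h'
  · simp only [projr_inr, wordNorm_inr hS hT]
    exact Or.inr ⟨h', le_rfl, le_rfl⟩

theorem floydEDist_inr_le {f : ℕ → ℝ} (hf : IsFloydFunction f) {S : Set A} {T : Set B}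
    (hS : Subgroup.closure S = ⊤) (hT : Subgroup.closure T = ⊤) (b b' : B) :
    floydEDist f (freeProductGenerators S T) (Coprod.inr b) (Coprod.inr b') ≤
      floydEDist f T b b' :=
  floydEDist_map_le hf (fun x => (Coprod.inr x : Coprod A B)) (fun _ _ h =>
    Or.inr ⟨mulCayley_adj_inr h, (wordNorm_inr hS hT _).ge, (wordNorm_inr hS hT _).ge⟩) b b'

end FreeProductMetric

/-! ### Bijections that move points less and less in a totally bounded space. -/

section CloseBijections

open Filter

/-- A countable family of infinite sets has an injective choice function. -/
theorem exists_injective_forall_mem {ι X : Type*} [Countable ι] (T : ι → Set X)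
    (hT : ∀ i, (T i).Infinite) : ∃ φ : ι → X, Function.Injective φ ∧ ∀ i, φ i ∈ T i := by
  classical
  obtain ⟨e, he⟩ := exists_injective_nat ι
  -- The size `e i + 1` ensures Hall's condition: if `m` has the largest index in `s`, then `t m`
  -- alone has at least as many elements as `s`.
  choose t ht hcard using fun i => (hT i).exists_subset_card_eq (e i + 1)
  obtain ⟨φ, hφ, hmem⟩ := (Finset.all_card_le_biUnion_card_iff_exists_injective t).1 fun s => by
    rcases s.eq_empty_or_nonempty with rfl | hs
    · simp
    obtain ⟨m, hm, hmax⟩ := s.exists_max_image e hs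
    calc s.card = (s.image e).card := (Finset.card_image_of_injective s he).symm
      _ ≤ (Finset.range (e m + 1)).card := Finset.card_le_card fun k hk => by
          obtain ⟨i, hi, rfl⟩ := Finset.mem_image.1 hk
          exact Finset.mem_range.2 (Nat.lt_succ_of_le (hmax i hi))
      _ = (t m).card := by rw [Finset.card_range, hcard]
      _ ≤ _ := Finset.card_le_card (Finset.subset_biUnion_of_mem t hm)
  exact ⟨φ, hφ, fun i => ht i (hmem i)⟩

variable {K : Type*} [PseudoEMetricSpace K] {X Y : Type*}

/-- Each `x` is assigned the smallest available radius `1 / (n + 1)` whose ball still has infinitely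
many candidates, and distinct choices are then made from these infinite sets. -/
theorem exists_injective_close [Countable X] [Infinite Y] {p : X → K} {q : Y → K}
    (h : ∀ ε > 0, ∀ᶠ x in cofinite, {y | edist (p x) (q y) < ε}.Infinite) :
    ∃ φ : X → Y, Function.Injective φ ∧ ∀ ε > 0, ∀ᶠ x in cofinite, edist (p x) (q (φ x)) < ε := by
  classical
  obtain ⟨e, he⟩ := exists_injective_nat X
  let P : X → ℕ → Prop := fun x n => {y | edist (p x) (q y) < (n + 1 : ℝ≥0∞)⁻¹}.Infinite
  -- The cap `e x` makes the maximum exist; it tends to infinity along `cofinite`, so it does not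
  -- prevent the radii from shrinking.
  let k : X → ℕ := fun x => Nat.findGreatest (P x) (e x)
  -- If no level up to `e x` works, `Nat.findGreatest` returns `0`; no closeness is then imposed on
  -- `x`, which matters for finitely many `x` only.
  let T : X → Set Y := fun x =>
    if P x (k x) then {y | edist (p x) (q y) < (k x + 1 : ℝ≥0∞)⁻¹} else Set.univ
  obtain ⟨φ, hφ, hmem⟩ := exists_injective_forall_mem T fun x => by
    by_cases hx : P x (k x)
    · simp only [T, if_pos hx]
      exact hx
    · simp only [T, if_neg hx]
      exact Set.infinite_univ
  refine ⟨φ, hφ, fun ε hε => ?_⟩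
  obtain ⟨n, hn⟩ := ENNReal.exists_inv_nat_lt hε.ne'
  have h1 : ∀ᶠ x in cofinite, n ≤ e x := by
    have := he.tendsto_cofinite
    rw [Nat.cofinite_eq_atTop] at this
    exact this.eventually_ge_atTop n
  filter_upwards [h1, h (n + 1 : ℝ≥0∞)⁻¹ (by simp)] with x hx1 hx2
  have hP : P x (k x) := Nat.findGreatest_spec (P := P x) hx1 hx2
  have hk : n ≤ k x := Nat.le_findGreatest hx1 hx2
  have := hmem x
  simp only [T, if_pos hP] at this
  refine (lt_of_lt_of_le this ?_).trans hn
  rw [ENNReal.inv_le_inv]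
  exact (Nat.cast_le.2 hk).trans le_self_add

/-- In the Schröder-Bernstein construction every pair matched by the bijection is already matched by
one of the two injections, so the bijection inherits their closeness. -/
theorem exists_equiv_close [Countable X] [Countable Y] [Infinite X] [Infinite Y]
    {p : X → K} {q : Y → K}
    (hX : ∀ ε > 0, ∀ᶠ x in cofinite, {y | edist (p x) (q y) < ε}.Infinite)
    (hY : ∀ ε > 0, ∀ᶠ y in cofinite, {x | edist (q y) (p x) < ε}.Infinite) :
    ∃ e : X ≃ Y, ∀ ε > 0, ∀ᶠ x in cofinite, edist (p x) (q (e x)) < ε := by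
  obtain ⟨φ, hφ, hφ'⟩ := exists_injective_close hX
  obtain ⟨ψ, hψ, hψ'⟩ := exists_injective_close hY
  obtain ⟨e, he, hR⟩ := Function.Embedding.schroeder_bernstein_of_rel hφ hψ
    (fun x y => y = φ x ∨ x = ψ y) (fun x => Or.inl rfl) (fun y => Or.inr rfl)
  refine ⟨Equiv.ofBijective e he, fun ε hε => ?_⟩
  have h2 := (he.1.tendsto_cofinite).eventually (hψ' ε hε)
  filter_upwards [hφ' ε hε, h2] with x hx1 hx2
  rcases hR x with h | h
  · simpa [h] using hx1
  · rw [edist_comm, ← h] at hx2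
    exact hx2

/-- Among finitely many balls of radius `ε / 2` that cover the space, the finite ones contain only
finitely many points. Any other point lies in an infinite ball, which its own `ε`-ball contains. -/
theorem eventually_infinite_ball
    (hK : ∀ ε > (0 : ℝ≥0∞), ∃ B : Set K, B.Finite ∧ ∀ a, ∃ b ∈ B, edist b a < ε) {ε : ℝ≥0∞}
    (hε : 0 < ε) : ∀ᶠ a : K in cofinite, {b | edist a b < ε}.Infinite := by
  obtain ⟨B, hB, hcov⟩ := hK (ε / 2) (ENNReal.half_pos hε.ne')
  have hfin : (⋃ b ∈ {b ∈ B | {a | edist b a < ε / 2}.Finite}, {a | edist b a < ε / 2}).Finite :=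
    (hB.subset (Set.sep_subset _ _)).biUnion fun b hb => hb.2
  filter_upwards [hfin.compl_mem_cofinite] with a ha
  obtain ⟨b, hb, hba⟩ := hcov a
  have hinf : {c | edist b c < ε / 2}.Infinite := fun h =>
    ha (Set.mem_biUnion (⟨hb, h⟩ : b ∈ {b ∈ B | {a | edist b a < ε / 2}.Finite}) hba)
  refine hinf.mono fun c hc => ?_
  calc edist a c ≤ edist a b + edist b c := edist_triangle _ _ _
    _ < ε / 2 + ε / 2 := ENNReal.add_lt_add (by rwa [edist_comm]) hc
    _ = ε := ENNReal.add_halves ε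

theorem infinite_ball_of_cofinite_range {q : Y → K} (hq : (Set.range q)ᶜ.Finite) {a : K}
    {ε : ℝ≥0∞} (h : {b | edist a b < ε}.Infinite) : {y | edist a (q y) < ε}.Infinite := by
  intro hfin
  refine (h.sdiff hq) ((hfin.image q).subset ?_)
  rintro b ⟨hb, hb'⟩
  obtain ⟨y, rfl⟩ := not_not.1 hb'
  exact ⟨y, hb, rfl⟩

/-- Over a totally bounded space, two countable infinite sets with finite-to-one maps of cofinite
range admit a bijection that moves points less and less. -/
theorem exists_equiv_close_of_cofinite_range [Countable X] [Countable Y] [Infinite X] [Infinite Y]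
    (hK : ∀ ε > (0 : ℝ≥0∞), ∃ B : Set K, B.Finite ∧ ∀ a, ∃ b ∈ B, edist b a < ε)
    {p : X → K} {q : Y → K} (hp : Tendsto p cofinite cofinite) (hq : Tendsto q cofinite cofinite)
    (hp' : (Set.range p)ᶜ.Finite) (hq' : (Set.range q)ᶜ.Finite) :
    ∃ e : X ≃ Y, ∀ ε > 0, ∀ᶠ x in cofinite, edist (p x) (q (e x)) < ε := by
  exact exists_equiv_close
    (fun ε hε => (hp.eventually (eventually_infinite_ball hK hε)).mono fun x hx =>
      infinite_ball_of_cofinite_range hq' hx)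
    (fun ε hε => (hq.eventually (eventually_infinite_ball hK hε)).mono fun x hx =>
      infinite_ball_of_cofinite_range hp' hx)

end CloseBijections

/-! ### Codings of groups by words, and a criterion for them. -/

section Coding

open Filter

theorem exists_pos_forall_mem_le {ι : Type*} {W : Set ι} (hW : W.Finite) {p : ι → ℝ≥0∞ → Prop}
    (hp : ∀ i ∈ W, ∃ δ > 0, ∀ η ≤ δ, p i η) : ∃ δ > 0, ∀ i ∈ W, ∀ η ≤ δ, p i η := by
  induction W, hW using Set.Finite.induction_on with
  | empty => exact ⟨1, one_pos, by simp⟩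
  | @insert a s _ _ ih =>
    obtain ⟨δ, hδ, h⟩ := ih fun i hi => hp i (Set.mem_insert_of_mem _ hi)
    obtain ⟨δ', hδ', h'⟩ := hp a (Set.mem_insert _ _)
    refine ⟨min δ δ', lt_min hδ hδ', fun i hi η hη => ?_⟩
    rcases hi with rfl | hi
    · exact h' η (hη.trans (min_le_right _ _))
    · exact h i hi η (hη.trans (min_le_left _ _))

theorem exists_pos_forall_mul_lt {C ε : ℝ≥0∞} (hC : C ≠ ∞) (hε : 0 < ε) :
    ∃ δ > 0, ∀ η ≤ δ, C * η < ε := by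
  obtain ⟨n, hn, h⟩ := ENNReal.exists_nnreal_pos_mul_lt hC hε.ne'
  refine ⟨n, by exact_mod_cast hn, fun η hη => lt_of_le_of_lt ?_ h⟩
  rw [mul_comm]
  gcongr

/-- A last letter may be decoded differently from an inner one. Words therefore count as diverging
at a common letter if exactly one of them ends there. -/
theorem List.exists_divergence {L : Type*} : ∀ {l l' : List L}, l ≠ [] → l' ≠ [] → l ≠ l' →
    ∃ w c t c' t', l = w ++ c :: t ∧ l' = w ++ c' :: t' ∧ (c ≠ c' ∨ ¬(t = [] ↔ t' = []))
  | [], _, h, _, _ => absurd rfl h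
  | _, [], _, h, _ => absurd rfl h
  | c :: t, c' :: t', _, _, h => by
    by_cases hd : c ≠ c' ∨ ¬(t = [] ↔ t' = [])
    · exact ⟨[], c, t, c', t', rfl, rfl, hd⟩
    · obtain ⟨rfl, ht⟩ : c = c' ∧ (t = [] ↔ t' = []) := by simpa using hd
      have hne : t ≠ t' := fun h0 => h (by rw [h0])
      have ht0 : t ≠ [] := fun h0 => hne (by rw [h0, ht.1 h0])
      obtain ⟨w, d, s, d', s', rfl, rfl, h'⟩ :=
        List.exists_divergence ht0 (fun h0 => ht0 (ht.2 h0)) hne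
      exact ⟨c :: w, d, s, d', s', rfl, rfl, h'⟩

variable {f : ℕ → ℝ} {A G H : Type*} [Group A] [Group G] [Group H]

/-- A bijection from the non-empty words over `A` to `G` under which two elements of `G` are
Floyd-close exactly if their words diverge late, or else diverge at letters that are Floyd-close
to each other and far out. -/
structure IsFloydCoding (f : ℕ → ℝ) (S : Set A) (R : Set G) (Φ : List A → G) : Prop where
  injective : ∀ l l', l ≠ [] → l' ≠ [] → Φ l = Φ l' → l = l'
  surjective : ∀ g, ∃ l, l ≠ [] ∧ Φ l = g
  upper : ∀ ε > 0, ∃ W : Set (List A), W.Finite ∧ ∃ E : Set A, E.Finite ∧ ∃ δ > 0,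
    ∀ w c t c' t', (w ∉ W ∨ (c ∉ E ∧ c' ∉ E ∧ floydEDist f S c c' < δ)) →
      floydEDist f R (Φ (w ++ c :: t)) (Φ (w ++ c' :: t')) < ε
  lower : ∀ w, ∀ E : Set A, E.Finite → ∀ δ > 0, ∃ ε > 0, ∀ c t c' t',
    (c ≠ c' ∨ ¬(t = [] ↔ t' = [])) →
      floydEDist f R (Φ (w ++ c :: t)) (Φ (w ++ c' :: t')) < ε →
        c ∉ E ∧ c' ∉ E ∧ floydEDist f S c c' < δ

/-- Closeness in `H` follows from a condition on the words alone, at finitely many prefixes `w`;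
closeness in `G` enforces that condition at each of them. -/
theorem IsFloydCoding.exists_floydEDist_lt {S : Set A} {R : Set G} {R' : Set H}
    {Φ : List A → G} {Ψ : List A → H} (hΦ : IsFloydCoding f S R Φ) (hΨ : IsFloydCoding f S R' Ψ)
    {ε : ℝ≥0∞} (hε : 0 < ε) : ∃ δ > 0, ∀ l l', l ≠ [] → l' ≠ [] →
      floydEDist f R (Φ l) (Φ l') < δ → floydEDist f R' (Ψ l) (Ψ l') < ε := by
  obtain ⟨W, hW, E, hE, η, hη, h⟩ := hΨ.upper ε hε
  obtain ⟨δ, hδ, h'⟩ := exists_pos_forall_mem_le hW (p := fun w δ => ∀ c t c' t',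
    (c ≠ c' ∨ ¬(t = [] ↔ t' = [])) →
      floydEDist f R (Φ (w ++ c :: t)) (Φ (w ++ c' :: t')) < δ →
        c ∉ E ∧ c' ∉ E ∧ floydEDist f S c c' < η) fun w _ => by
    obtain ⟨δ, hδ, h'⟩ := hΦ.lower w E hE η hη
    exact ⟨δ, hδ, fun δ' hδ' c t c' t' hd hlt => h' c t c' t' hd (hlt.trans_le hδ')⟩
  refine ⟨δ, hδ, fun l l' hl hl' hlt => ?_⟩
  by_cases hne : l = l'
  · simpa [hne, floydEDist_self] using hε
  obtain ⟨w, c, t, c', t', rfl, rfl, hd⟩ := List.exists_divergence hl hl' hne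
  refine h w c t c' t' ?_
  by_cases hw : w ∈ W
  · exact Or.inr (h' w hw δ le_rfl c t c' t' hd hlt)
  · exact Or.inl hw

/-- A bijection of groups that is uniformly continuous in both directions for the Floyd metrics
induces a homeomorphism of the Floyd boundaries. -/
theorem nonempty_floydBoundary_homeomorph {R : Set G} {R' : Set H} (e : G ≃ H)
    (h : ∀ ε > 0, ∃ δ > 0, ∀ g g', floydEDist f R g g' < δ → floydEDist f R' (e g) (e g') < ε)
    (h' : ∀ ε > 0, ∃ δ > 0, ∀ g g',
      floydEDist f R' g g' < δ → floydEDist f R (e.symm g) (e.symm g') < ε) :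
    Nonempty (floydBoundary f R ≃ₜ floydBoundary f R') := by
  let F : FloydSpace f R → FloydSpace f R' := e
  let F' : FloydSpace f R' → FloydSpace f R := e.symm
  have hF : UniformContinuous F := EMetric.uniformContinuous_iff.2 fun ε hε => by
    obtain ⟨δ, hδ, h0⟩ := h ε hε
    exact ⟨δ, hδ, fun {a b} hab => h0 a b hab⟩
  have hF' : UniformContinuous F' := EMetric.uniformContinuous_iff.2 fun ε hε => by
    obtain ⟨δ, hδ, h0⟩ := h' ε hε
    exact ⟨δ, hδ, fun {a b} hab => h0 a b hab⟩
  let E : FloydSpace f R ≃ᵤ FloydSpace f R' :=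
    ⟨⟨F, F', e.left_inv, e.right_inv⟩, hF, hF'⟩
  let Ec := UniformSpace.Completion.mapEquiv E
  have hE : ∀ x : FloydSpace f R, Ec (x : UniformSpace.Completion (FloydSpace f R)) = (F x : _) :=
    fun x => UniformSpace.Completion.map_coe hF x
  refine ⟨Ec.toHomeomorph.subtype fun x => ?_⟩
  simp only [floydBoundary, Set.mem_compl_iff, not_iff_not]
  constructor
  · rintro ⟨x, rfl⟩
    exact ⟨F x, (hE x).symm⟩
  · rintro ⟨y, hy⟩
    refine ⟨F' y, Ec.injective ?_⟩
    rw [hE]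
    exact (congrArg _ (e.right_inv y)).trans hy

theorem IsFloydCoding.nonempty_homeomorph {S : Set A} {R : Set G} {R' : Set H}
    {Φ : List A → G} {Ψ : List A → H} (hΦ : IsFloydCoding f S R Φ)
    (hΨ : IsFloydCoding f S R' Ψ) : Nonempty (floydBoundary f R ≃ₜ floydBoundary f R') := by
  choose u hu0 hu using hΦ.surjective
  choose v hv0 hv using hΨ.surjective
  have hvu : ∀ g, v (Ψ (u g)) = u g := fun g =>
    hΨ.injective _ _ (hv0 _) (hu0 _) (hv _)
  have huv : ∀ g, u (Φ (v g)) = v g := fun g =>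
    hΦ.injective _ _ (hu0 _) (hv0 _) (hu _)
  refine nonempty_floydBoundary_homeomorph
    ⟨fun g => Ψ (u g), fun h => Φ (v h), fun g => by simp [hvu, hu], fun h => by simp [huv, hv]⟩
    (fun ε hε => ?_) (fun ε hε => ?_)
  · obtain ⟨δ, hδ, h⟩ := hΦ.exists_floydEDist_lt hΨ hε
    exact ⟨δ, hδ, fun g g' hg => h _ _ (hu0 _) (hu0 _) (by rwa [hu, hu])⟩
  · obtain ⟨δ, hδ, h⟩ := hΨ.exists_floydEDist_lt hΦ hε
    exact ⟨δ, hδ, fun g g' hg => h _ _ (hv0 _) (hv0 _) (by rwa [hv, hv])⟩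

/-- A value `a = α c` with `c ≠ a` keeps `c` at distance at least `f |a|` from `α c`. So each `a` is
attained only finitely often, and `α c` leaves every ball. -/
theorem eventually_wordNorm_gt (hf : IsFloydFunction f) {S : Set A}
    (hS : Subgroup.closure S = ⊤) (hfin : S.Finite) {α : A → A}
    (hα : ∀ ε > 0, ∀ᶠ c in cofinite, floydEDist f S (α c) c < ε) (n : ℕ) :
    ∀ᶠ c in cofinite, n < wordNorm S (α c) := by
  have h : ∀ᶠ c in cofinite, ∀ a ∈ {a | wordNorm S a ≤ n}, α c ≠ a := by
    rw [eventually_all_finite (finite_wordNorm_le hS hfin n)]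
    intro a _
    filter_upwards [hα _ (ENNReal.ofReal_pos.2 (hf.pos (wordNorm S a))),
      (Set.finite_singleton a).compl_mem_cofinite] with c hc hca h0
    rw [h0] at hc
    exact (le_floydEDist_of_ne hf (Ne.symm hca)).not_gt hc
  filter_upwards [h] with c hc
  by_contra hle
  exact hc _ (not_lt.1 hle) rfl

/-- A criterion for codings: the word `w` leads to the element `U w`, and the words
`w ++ c :: t` lead to elements that branch off the coset of `U w` at the position `α w c`. -/
theorem isFloydCoding_of_branching (hf : IsFloydFunction f) {S : Set A} {R : Set G}
    (hS : Subgroup.closure S = ⊤) (hSfin : S.Finite) (hR : Subgroup.closure R = ⊤)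
    {Φ U : List A → G} {α : List A → A → Bool → A} {ι : List A → A → G}
    (hinj : ∀ l l', l ≠ [] → l' ≠ [] → Φ l = Φ l' → l = l')
    (hsurj : ∀ g, ∃ l, l ≠ [] ∧ Φ l = g)
    (hU : ∀ n, {w | wordNorm R (U w) ≤ n}.Finite)
    (hUΦ : ∀ w c t, wordNorm R (Φ (w ++ c :: t)) =
      wordNorm R (U w) + wordNorm R ((U w)⁻¹ * Φ (w ++ c :: t)))
    (hιΦ : ∀ w c t, wordNorm R (Φ (w ++ c :: t)) =
      wordNorm R (U w * ι w (α w c t.isEmpty)) +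
        wordNorm R ((U w * ι w (α w c t.isEmpty))⁻¹ * Φ (w ++ c :: t)))
    (hα : ∀ w b, ∀ ε > 0, ∀ᶠ c in cofinite, floydEDist f S (α w c b) c < ε)
    (hιd : ∀ w a a', floydEDist f R (ι w a) (ι w a') ≤ floydEDist f S a a')
    (hιn : ∀ w a, wordNorm S a ≤ wordNorm R (ι w a))
    (hproj : ∀ w, ∃ C, C ≠ ∞ ∧ ∀ c t c' t',
      floydEDist f S (α w c t.isEmpty) (α w c' t'.isEmpty) ≤
        C * floydEDist f R (Φ (w ++ c :: t)) (Φ (w ++ c' :: t')))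
    (hsep : ∀ w a, ∃ η > 0, ∀ c t c' t', (c ≠ c' ∨ ¬(t = [] ↔ t' = [])) →
      α w c t.isEmpty = a → α w c' t'.isEmpty = a →
        η ≤ floydEDist f R (Φ (w ++ c :: t)) (Φ (w ++ c' :: t'))) :
    IsFloydCoding f S R Φ := by
  have hev : ∀ w (n : ℕ) ε, 0 < ε → ∀ᶠ c in cofinite, ∀ b,
      floydEDist f S (α w c b) c < ε ∧ n < wordNorm S (α w c b) := fun w n ε hε =>
    eventually_all.2 fun b => (hα w b ε hε).and (eventually_wordNorm_gt hf hS hSfin (hα w b) n)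
  have tail : ∀ {x y : G}, wordNorm R y = wordNorm R x + wordNorm R (x⁻¹ * y) →
      floydEDist f R x y ≤ floydTail f (wordNorm R x) := fun {x y} h => by
    simpa using floydEDist_mul_le_floydTail hf hR (u := x) (t := x⁻¹ * y) (by simpa using h)
  refine ⟨hinj, hsurj, fun ε hε => ?_, fun w E hE δ hδ => ?_⟩
  · have hε3 : 0 < ε / 3 := ENNReal.div_pos hε.ne' (by simp)
    obtain ⟨N, hN⟩ := exists_floydTail_lt hf hε3
    -- Only these finitely many prefixes need care: for any other `w`, both elements lie behind `U
    -- w` and are within a small tail of it.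
    have key : ∀ w ∈ {w | wordNorm R (U w) ≤ N}, ∃ δ > 0, ∀ η ≤ δ,
        ∃ E : Set A, E.Finite ∧ ∀ c t c' t', c ∉ E → c' ∉ E → floydEDist f S c c' < η →
          floydEDist f R (Φ (w ++ c :: t)) (Φ (w ++ c' :: t')) < ε := by
      intro w _
      obtain ⟨C, -, hC, hCle⟩ := floydEDist_mul_left_le hf hR (U w)
      obtain ⟨δ, hδ, hCδ⟩ := exists_pos_forall_mul_lt (C := C * 3)
        (ENNReal.mul_ne_top hC (by simp)) hε3
      -- The summand `wordNorm R (U w)` compensates for the translation by `U w`, so that the branch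
      -- points themselves have norm at least `N`. The factor `3` in `C * 3` pays for the route from
      -- position to letter, to the other letter, to its position.
      refine ⟨δ, hδ, fun η hη => ⟨_, hev w (N + wordNorm R (U w)) δ hδ, ?_⟩⟩
      intro c t c' t' hc hc' hcc
      simp only [Set.mem_compl_iff, Set.mem_ofPred_eq, not_not] at hc hc'
      obtain ⟨h1, h2⟩ := hc t.isEmpty
      obtain ⟨h1', h2'⟩ := hc' t'.isEmpty
      set a := α w c t.isEmpty
      set a' := α w c' t'.isEmpty
      have far : ∀ b, N + wordNorm R (U w) < wordNorm S b → N ≤ wordNorm R (U w * ι w b) := by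
        intro b hb
        have h3 := wordNorm_le_mul_left hR (U w) (ι w b)
        have h4 := hιn w b
        omega
      have hmid : floydEDist f R (U w * ι w a) (U w * ι w a') < ε / 3 := by
        refine lt_of_le_of_lt ?_ (hCδ δ le_rfl)
        rw [mul_assoc]
        refine (hCle _ _).trans ?_
        gcongr
        calc _ ≤ floydEDist f S a a' := hιd w a a'
          _ ≤ floydEDist f S a c + floydEDist f S c c' + floydEDist f S c' a' :=
            (floydEDist_triangle _ _ _ c' _).trans
              (add_le_add_left (floydEDist_triangle _ _ _ _ _) _)
          _ ≤ δ + δ + δ := by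
            gcongr
            · exact hcc.le.trans hη
            · rw [floydEDist_comm]
              exact h1'.le
          _ = 3 * δ := by ring
      calc _ ≤ floydEDist f R (Φ (w ++ c :: t)) (U w * ι w a) +
              floydEDist f R (U w * ι w a) (U w * ι w a') +
              floydEDist f R (U w * ι w a') (Φ (w ++ c' :: t')) :=
            (floydEDist_triangle _ _ _ (U w * ι w a') _).trans
              (add_le_add_left (floydEDist_triangle _ _ _ _ _) _)
        _ < ε / 3 + ε / 3 + ε / 3 := by
            refine ENNReal.add_lt_add (ENNReal.add_lt_add ?_ hmid) ?_
            · rw [floydEDist_comm]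
              exact (tail (hιΦ w c t)).trans_lt (hN _ (far a h2))
            · exact (tail (hιΦ w c' t')).trans_lt (hN _ (far a' h2'))
        _ = ε := ENNReal.add_thirds ε
    obtain ⟨δ, hδ, h⟩ := exists_pos_forall_mem_le (hU N) key
    choose! E hE h using fun w hw => h w hw δ le_rfl
    refine ⟨_, hU N, ⋃ w ∈ {w | wordNorm R (U w) ≤ N}, E w, (hU N).biUnion hE, δ, hδ, ?_⟩
    rintro w c t c' t' hw
    by_cases hwN : w ∈ {w | wordNorm R (U w) ≤ N}
    · obtain ⟨h1, h2, h3⟩ := hw.resolve_left (not_not.2 hwN)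
      exact h w hwN c t c' t' (fun h0 => h1 (Set.mem_biUnion hwN h0))
        (fun h0 => h2 (Set.mem_biUnion hwN h0)) h3
    · have hN' := hN _ (not_le.1 hwN).le
      calc _ ≤ floydEDist f R (Φ (w ++ c :: t)) (U w) + floydEDist f R (U w) (Φ (w ++ c' :: t')) :=
            floydEDist_triangle _ _ _ _ _
        _ < ε / 3 + ε / 3 := by
            refine ENNReal.add_lt_add ?_ ?_
            · rw [floydEDist_comm]
              exact (tail (hUΦ w c t)).trans_lt hN'
            · exact (tail (hUΦ w c' t')).trans_lt hN'
        _ ≤ ε / 3 + ε / 3 + ε / 3 := le_self_add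
        _ = ε := ENNReal.add_thirds ε
  · have hδ3 : 0 < δ / 3 := ENNReal.div_pos hδ.ne' (by simp)
    obtain ⟨C, hC, hCle⟩ := hproj w
    -- Besides `E`, the letters whose positions are not yet close to them must be excluded.
    set E' : Set A := E ∪ {c | ∀ b, floydEDist f S (α w c b) c < δ / 3 ∧ 0 < wordNorm S (α w c b)}ᶜ
    have hE' : E'.Finite := hE.union (hev w 0 _ hδ3)
    have hbad : (⋃ c ∈ E', Set.range (α w c)).Finite :=
      hE'.biUnion fun c _ => Set.finite_range _
    obtain ⟨ε₁, hε₁, h1⟩ := exists_pos_forall_mem_le hbad (p := fun a ε =>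
      C * ε < ENNReal.ofReal (f (wordNorm S a)) ∧ ∀ c t c' t',
        (c ≠ c' ∨ ¬(t = [] ↔ t' = [])) → α w c t.isEmpty = a → α w c' t'.isEmpty = a →
        ε ≤ floydEDist f R (Φ (w ++ c :: t)) (Φ (w ++ c' :: t'))) fun a _ => by
      obtain ⟨η, hη, h⟩ := hsep w a
      obtain ⟨η', hη', h'⟩ := exists_pos_forall_mul_lt hC
        (ENNReal.ofReal_pos.2 (hf.pos (wordNorm S a)))
      exact ⟨min η η', lt_min hη hη', fun x hx => ⟨h' x (hx.trans (min_le_right _ _)),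
        fun c t c' t' hd ha ha' => (hx.trans (min_le_left _ _)).trans (h c t c' t' hd ha ha')⟩⟩
    obtain ⟨ε₂, hε₂, h2⟩ := exists_pos_forall_mul_lt hC hδ3
    -- A letter in `E'` has one of finitely many positions `a`. If the other word branches off
    -- elsewhere, isolation of `a` contradicts `hproj`; if it branches off at `a` too, `hsep`
    -- separates the words.
    have key : ∀ c t c' t', (c ≠ c' ∨ ¬(t = [] ↔ t' = [])) →
        floydEDist f R (Φ (w ++ c :: t)) (Φ (w ++ c' :: t')) < min ε₁ ε₂ → c ∉ E' := by
      intro c t c' t' hd hlt hc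
      have ha : α w c t.isEmpty ∈ ⋃ c ∈ E', Set.range (α w c) :=
        Set.mem_biUnion hc ⟨_, rfl⟩
      obtain ⟨h3, h4⟩ := h1 _ ha ε₁ le_rfl
      refine (h4 c t c' t' hd rfl ?_).not_gt (hlt.trans_le (min_le_left _ _))
      by_contra hne
      refine (le_floydEDist_of_ne hf (Ne.symm hne)).not_gt (lt_of_le_of_lt ?_ h3)
      exact (hCle c t c' t').trans (mul_le_mul_right (hlt.le.trans (min_le_left _ _)) _)
    refine ⟨min ε₁ ε₂, lt_min hε₁ hε₂, fun c t c' t' hd hlt => ?_⟩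
    have hc := key c t c' t' hd hlt
    have hc' := key c' t' c t (hd.imp Ne.symm fun h h' => h h'.symm) (by rwa [floydEDist_comm])
    simp only [E', Set.mem_union, Set.mem_compl_iff, Set.mem_ofPred_eq, not_or, not_not] at hc hc'
    refine ⟨hc.1, hc'.1, ?_⟩
    calc _ ≤ floydEDist f S c (α w c t.isEmpty) +
            floydEDist f S (α w c t.isEmpty) (α w c' t'.isEmpty) +
            floydEDist f S (α w c' t'.isEmpty) c' :=
          (floydEDist_triangle _ _ _ (α w c' t'.isEmpty) _).trans
            (add_le_add_left (floydEDist_triangle _ _ _ _ _) _)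
      _ < δ / 3 + δ / 3 + δ / 3 := by
          refine ENNReal.add_lt_add (ENNReal.add_lt_add ?_ ?_) (hc'.2 _).1
          · rw [floydEDist_comm]
            exact (hc.2 _).1
          · exact (hCle c t c' t').trans_lt (h2 _ (hlt.le.trans (min_le_right _ _)))
      _ = δ := ENNReal.add_thirds δ

end Coding

/-! ### Independence of the generating set under the doubling condition. -/

section ChangeOfGenerators

variable {f : ℕ → ℝ} {G : Type*} [Group G]

theorem exists_wordNorm_le_mul {S T : Set G} (hS : Subgroup.closure S = ⊤) (hfin : S.Finite)
    (hT : Subgroup.closure T = ⊤) : ∃ K, ∀ g, wordNorm T g ≤ K * wordNorm S g := by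
  obtain ⟨K, hK⟩ := ((finite_wordNorm_le hS hfin 1).image (wordNorm T)).bddAbove
  refine ⟨K, fun g => ?_⟩
  induction hn : wordNorm S g generalizing g with
  | zero => simp [wordNorm_eq_zero hS hn, wordNorm_one]
  | succ n ih =>
    obtain ⟨v, t, rfl, hv, ht⟩ := exists_wordNorm_eq hS (n := n) (g := g) (by omega)
    have h1 : wordNorm T t ≤ K := hK ⟨t, show wordNorm S t ≤ 1 by omega, rfl⟩
    calc _ ≤ wordNorm T v + wordNorm T t := wordNorm_mul_le hT _ _
      _ ≤ K * n + K := Nat.add_le_add (ih v hv) h1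
      _ = K * (n + 1) := by ring

/-- All vertices of the path have norm at least `m`. The alternative `m = 0` covers the truncated
subtraction in `m = |u| - K`, where `f 0` bounds every edge. -/
theorem floydLength_le_length_mul (hf : IsFloydFunction f) {S : Set G}
    (hS : Subgroup.closure S = ⊤) {u v : G} (p : (SimpleGraph.mulCayley S).Walk u v) (m : ℕ)
    (h : m + p.length ≤ wordNorm S u ∨ m = 0) :
    floydLength f S p ≤ p.length * ENNReal.ofReal (f m) := by
  induction p with
  | nil => simp [floydLength]
  | @cons u v w hadj p ih =>
    rw [floydLength_cons, SimpleGraph.Walk.length_cons, Nat.cast_succ, add_mul, one_mul, add_comm]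
    rw [SimpleGraph.Walk.length_cons] at h
    have h1 := wordNorm_le_mul_right hS u (u⁻¹ * v)
    rw [mul_inv_cancel_left] at h1
    have h2 := wordNorm_inv_mul_le_one hS hadj
    refine add_le_add (ih (by omega)) (ENNReal.ofReal_le_ofReal (hf.antitone (le_min ?_ ?_)))
    · change m ≤ wordNorm S u
      omega
    · change m ≤ wordNorm S v
      omega

theorem IsFloydFunction.exists_le_mul_of_doubling (hf : IsFloydFunction f)
    (hD : ∃ D : ℝ, ∀ n, 1 ≤ n → f n ≤ D * f (2 * n)) (K : ℕ) :
    ∃ C : ℝ, 0 < C ∧ ∀ m n, n ≤ K * (m + K) → f m ≤ C * f n := by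
  obtain ⟨D, hD⟩ := hD
  have hDpos : 0 < D := pos_of_mul_pos_left ((hf.pos 1).trans_le (hD 1 le_rfl)) (hf.pos _).le
  have hpow : ∀ j m, 1 ≤ m → f m ≤ D ^ j * f (2 ^ j * m) := by
    intro j m hm
    induction j with
    | zero => simp
    | succ j ih =>
      calc f m ≤ D ^ j * f (2 ^ j * m) := ih
        _ ≤ D ^ j * (D * f (2 * (2 ^ j * m))) := by
          gcongr
          exact hD _ (Nat.mul_pos (by positivity) hm)
        _ = D ^ (j + 1) * f (2 ^ (j + 1) * m) := by rw [← mul_assoc, ← mul_assoc]; ring_nf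
  have hK := hf.pos (K * K)
  -- The first summand serves `m ≥ 1`, where `n ≤ (K + K * K) * m ≤ 2 ^ (K + K * K) * m`; the second
  -- serves `m = 0`, where `n ≤ K * K`.
  refine ⟨D ^ (K + K * K) + f 0 / f (K * K),
    add_pos (pow_pos hDpos _) (div_pos (hf.pos 0) hK), fun m n h => ?_⟩
  rw [add_mul]
  rcases Nat.eq_zero_or_pos m with rfl | hm
  · refine le_add_of_nonneg_of_le (mul_pos (pow_pos hDpos _) (hf.pos _)).le ?_
    rw [div_mul_eq_mul_div, le_div_iff₀ hK]
    exact mul_le_mul_of_nonneg_left (hf.antitone (by simpa using h)) (hf.pos 0).le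
  · refine le_add_of_le_of_nonneg ((hpow (K + K * K) m hm).trans ?_)
      (mul_pos (div_pos (hf.pos 0) hK) (hf.pos _)).le
    refine mul_le_mul_of_nonneg_left (hf.antitone ?_) (pow_pos hDpos _).le
    calc n ≤ K * (m + K) := h
      _ ≤ (K + K * K) * m := by nlinarith [Nat.zero_le (K * K * (m - 1)), Nat.mul_le_mul_left (K * K) hm]
      _ ≤ 2 ^ (K + K * K) * m := Nat.mul_le_mul_right _ Nat.lt_two_pow_self.le

/-- For a Floyd function with the doubling property, the Floyd metrics of two finite generating
sets are Lipschitz equivalent. -/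
theorem exists_floydEDist_le_of_doubling (hf : IsFloydFunction f)
    (hD : ∃ D : ℝ, ∀ n, 1 ≤ n → f n ≤ D * f (2 * n)) {S T : Set G}
    (hS : Subgroup.closure S = ⊤) (hSfin : S.Finite) (hT : Subgroup.closure T = ⊤)
    (hTfin : T.Finite) : ∃ C : ℝ≥0∞, C ≠ ∞ ∧ ∀ u v, floydEDist f S u v ≤ C * floydEDist f T u v := by
  obtain ⟨K₁, hK₁⟩ := exists_wordNorm_le_mul hS hSfin hT
  obtain ⟨K₂, hK₂⟩ := exists_wordNorm_le_mul hT hTfin hS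
  set K := K₁ + K₂ + 1
  obtain ⟨C, hC, hCle⟩ := hf.exists_le_mul_of_doubling hD K
  have hC0 : (K : ℝ≥0∞) * ENNReal.ofReal C ≠ 0 := mul_ne_zero (by simp [K]) (by simpa using hC)
  have hCtop : (K : ℝ≥0∞) * ENNReal.ofReal C ≠ ∞ :=
    ENNReal.mul_ne_top (ENNReal.natCast_ne_top _) ENNReal.ofReal_ne_top
  refine ⟨_, hCtop, le_mul_floydEDist (floydEDist_self _ _)
    (floydEDist_triangle _ _) hC0 hCtop fun u v hadj => ?_⟩
  -- An edge for `T` is replaced by a geodesic for `S` with at most `K` edges, all at distance at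
  -- least `|u| - K` from the identity; doubling absorbs the distortion between the two norms.
  obtain ⟨p, hp⟩ := (mulCayley_connected hS).exists_walk_length_eq_dist u v
  have hlen : p.length ≤ K := by
    rw [hp, dist_eq_wordNorm hS]
    refine (hK₂ _).trans ?_
    have := Nat.mul_le_mul_left K₂ (wordNorm_inv_mul_le_one hT hadj)
    omega
  refine (iInf_le _ p).trans ((floydLength_le_length_mul hf hS p (wordNorm S u - K) (by omega)).trans ?_)
  rw [mul_assoc]
  refine mul_le_mul' (Nat.cast_le.2 hlen) ?_
  rw [← ENNReal.ofReal_mul hC.le]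
  refine ENNReal.ofReal_le_ofReal ((hCle _ (wordNorm T u) ?_).trans
    (mul_le_mul_of_nonneg_left (hf.antitone (min_le_left _ _)) hC.le))
  calc wordNorm T u ≤ K₁ * wordNorm S u := hK₁ u
    _ ≤ K * (wordNorm S u - K + K) := Nat.mul_le_mul (by omega) (by omega)

theorem nonempty_floydBoundary_homeomorph_of_doubling (hf : IsFloydFunction f)
    (hD : ∃ D : ℝ, ∀ n, 1 ≤ n → f n ≤ D * f (2 * n)) {S T : Set G}
    (hS : Subgroup.closure S = ⊤) (hSfin : S.Finite) (hT : Subgroup.closure T = ⊤)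
    (hTfin : T.Finite) : Nonempty (floydBoundary f S ≃ₜ floydBoundary f T) := by
  have key : ∀ {S T : Set G}, Subgroup.closure S = ⊤ → S.Finite → Subgroup.closure T = ⊤ →
      T.Finite → ∀ ε > 0, ∃ δ > 0, ∀ g g', floydEDist f S g g' < δ → floydEDist f T g g' < ε := by
    intro S T hS hSfin hT hTfin ε hε
    obtain ⟨C, hC, h⟩ := exists_floydEDist_le_of_doubling hf hD hT hTfin hS hSfin
    obtain ⟨δ, hδ, h'⟩ := exists_pos_forall_mul_lt hC hε
    exact ⟨δ, hδ, fun g g' hg => (h g g').trans_lt (h' _ hg.le)⟩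
  exact nonempty_floydBoundary_homeomorph (Equiv.refl G) (key hS hSfin hT hTfin)
    (key hT hTfin hS hSfin)

end ChangeOfGenerators

/-! ### Asymptotically faithful relabelling of letters. -/

section FloydLetters

open Filter

variable {f : ℕ → ℝ} {A : Type*} [Group A]

theorem countable_of_finite_closure_eq_top {S : Set A} (hS : Subgroup.closure S = ⊤)
    (hfin : S.Finite) : Countable A := by
  rw [← Set.countable_univ_iff]
  refine (Set.countable_iUnion fun n => (finite_wordNorm_le hS hfin n).countable).mono fun a _ => ?_
  exact Set.mem_iUnion.2 ⟨wordNorm S a, le_refl (wordNorm S a)⟩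

/-- Source of all letter decodings: `X` is the set of decoded letters and `p` the position in `A`
from which they branch off. -/
theorem exists_equiv_floydEDist_lt (hf : IsFloydFunction f) {S : Set A}
    (hS : Subgroup.closure S = ⊤) (hfin : S.Finite) [Infinite A] {X : Type*} [Countable X]
    [Infinite X] {p : X → A} (hp : Tendsto p cofinite cofinite) (hp' : (Set.range p)ᶜ.Finite) :
    ∃ e : A ≃ X, ∀ ε > 0, ∀ᶠ c in cofinite, floydEDist f S (p (e c)) c < ε := by
  have : Countable A := countable_of_finite_closure_eq_top hS hfin
  obtain ⟨e, he⟩ := exists_equiv_close_of_cofinite_range (K := FloydSpace f S) (X := X) (Y := A)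
    (fun ε hε => exists_finite_floydEDist_lt hf hS hfin hε) (p := p) (q := fun a => a) hp
    tendsto_id hp' (Set.finite_empty.subset fun a ha => (ha ⟨a, rfl⟩).elim)
  refine ⟨e.symm, fun ε hε => ?_⟩
  have := (e.symm.injective.tendsto_cofinite).eventually (he ε hε)
  filter_upwards [this] with c hc
  rwa [Equiv.apply_symm_apply] at hc

theorem wordNorm_mul_mul_eq {S : Set A} (hS : Subgroup.closure S = ⊤) {u a y : A}
    (h : wordNorm S (u * (a * y)) = wordNorm S u + wordNorm S (a * y))
    (h' : wordNorm S (a * y) = wordNorm S a + wordNorm S y) :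
    wordNorm S (u * (a * y)) = wordNorm S (u * a) + wordNorm S y := by
  have h1 := wordNorm_mul_le hS (u * a) y
  have h2 := wordNorm_mul_le hS u a
  rw [mul_assoc] at h1
  omega

end FloydLetters

/-! ### Coding of the free product with a finite group. -/

section FiniteFactor

open Monoid Filter

variable {A B : Type*} [Group A] [Group B]

/-- The position in the left factor at which a letter `c` branches off: the letter itself if it is
the last one of its word, and otherwise the first component of its decoding. -/
def branchPos (dec : Bool → A → A × B) (r : Bool) (c : A) (last : Bool) : A :=
  bif last then c else (dec r c).1

/-- The product of the decoded letters of a word. The flag tells whether the first letter is at the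
root. -/
def prefixProd (dec : Bool → A → A × B) : Bool → List A → Coprod A B
  | _, [] => 1
  | r, c :: w => Coprod.inl (dec r c).1 * (Coprod.inr (dec r c).2 * prefixProd dec false w)

/-- The element of `A * B` that a word over `A` encodes: all letters but the last are decoded to
pairs. -/
def pairWordProd (dec : Bool → A → A × B) : Bool → List A → Coprod A B
  | _, [] => 1
  | r, c :: t => Coprod.inl (branchPos dec r c t.isEmpty) *
      (bif t.isEmpty then 1 else Coprod.inr (dec r c).2 * pairWordProd dec false t)

/-- A decoding of letters in `A` as pairs of non-trivial elements, where at the root the first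
component is arbitrary. -/
structure IsPairDecoding (dec : Bool → A → A × B) : Prop where
  fst_ne : ∀ c, (dec false c).1 ≠ 1
  snd_ne : ∀ r c, (dec r c).2 ≠ 1
  injective : ∀ r, Function.Injective (dec r)
  surjective : ∀ r a b, b ≠ 1 → (r = true ∨ a ≠ 1) → ∃ c, dec r c = (a, b)

variable {dec : Bool → A → A × B}

theorem pairWordProd_append (w : List A) (c : A) (t : List A) (r : Bool) :
    pairWordProd dec r (w ++ c :: t) =
      prefixProd dec r w * pairWordProd dec (r && w.isEmpty) (c :: t) := by
  induction w generalizing r with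
  | nil => simp [prefixProd]
  | cons d w ih =>
    have : (w ++ c :: t).isEmpty = false := by simp
    rw [List.cons_append, pairWordProd, this, ih]
    simp [branchPos, prefixProd, mul_assoc]

namespace IsPairDecoding

/-- Away from the root an inner letter has non-trivial first component, and a last letter lies in
`A`. So the product never starts in `B`, and nothing cancels or merges with a preceding letter of
`B`. -/
theorem projr_pairWordProd (h : IsPairDecoding dec) (t : List A) :
    projr (pairWordProd dec false t) = 1 := by
  induction t with
  | nil => exact projr_one
  | cons c t ih =>
    rw [pairWordProd]
    cases ht : t.isEmpty
    · simp only [cond_false, branchPos]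
      exact projr_inl_mul (h.fst_ne c) (projl_inr_mul (h.snd_ne _ c) ih)
    · simp [projr_inl]

theorem projl_tail (h : IsPairDecoding dec) (r : Bool) (c : A) (t : List A) :
    projl (bif t.isEmpty then 1 else Coprod.inr (dec r c).2 * pairWordProd dec false t) = 1 := by
  cases t.isEmpty
  · exact projl_inr_mul (h.snd_ne _ c) (h.projr_pairWordProd t)
  · exact projl_one

theorem projr_tail (h : IsPairDecoding dec) (r : Bool) (c : A) (t : List A) :
    projr (bif t.isEmpty then 1 else Coprod.inr (dec r c).2 * pairWordProd dec false t) =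
      bif t.isEmpty then 1 else (dec r c).2 := by
  cases t.isEmpty
  · simp [projr_inr_mul, h.projr_pairWordProd t]
  · exact projr_one

theorem projl_pairWordProd_cons (h : IsPairDecoding dec) (r : Bool) (c : A) (t : List A) :
    projl (pairWordProd dec r (c :: t)) = branchPos dec r c t.isEmpty := by
  rw [pairWordProd, projl_inl_mul, h.projl_tail, mul_one]

/-- Two words that branch off at the same position continue with different letters of `B`. -/
theorem eq_of_branchPos_eq (h : IsPairDecoding dec) {r : Bool} {c c' : A} {t t' : List A}
    (hpos : branchPos dec r c t.isEmpty = branchPos dec r c' t'.isEmpty)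
    (hsnd : (bif t.isEmpty then 1 else (dec r c).2) = bif t'.isEmpty then 1 else (dec r c').2) :
    c = c' ∧ (t = [] ↔ t' = []) := by
  rw [← List.isEmpty_iff, ← List.isEmpty_iff]
  cases ht : t.isEmpty <;> cases ht' : t'.isEmpty <;>
    simp only [ht, ht', cond_true, cond_false, branchPos] at hpos hsnd
  · exact ⟨h.injective r (Prod.ext hpos hsnd), Iff.rfl⟩
  · exact absurd hsnd (h.snd_ne r c)
  · exact absurd hsnd.symm (h.snd_ne r c')
  · exact ⟨hpos, Iff.rfl⟩

theorem pairWordProd_injective (h : IsPairDecoding dec) : ∀ (r : Bool) (l l' : List A),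
    l ≠ [] → l' ≠ [] → pairWordProd dec r l = pairWordProd dec r l' → l = l'
  | _, [], _, h0, _, _ => absurd rfl h0
  | _, _, [], _, h0, _ => absurd rfl h0
  | r, c :: t, c' :: t', _, _, heq => by
    have hpos := congrArg projl heq
    rw [h.projl_pairWordProd_cons, h.projl_pairWordProd_cons] at hpos
    rw [pairWordProd, pairWordProd, hpos, mul_right_inj] at heq
    have hsnd := congrArg projr heq
    rw [h.projr_tail, h.projr_tail] at hsnd
    obtain ⟨rfl, ht⟩ := h.eq_of_branchPos_eq hpos hsnd
    by_cases h0 : t = []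
    · rw [h0, ht.1 h0]
    · have h0' : t' ≠ [] := fun h1 => h0 (ht.2 h1)
      rw [List.isEmpty_eq_false_iff.2 h0, List.isEmpty_eq_false_iff.2 h0', cond_false, cond_false,
        mul_right_inj] at heq
      rw [h.pairWordProd_injective false t t' h0 h0' heq]

theorem inl_mul_inr_mul_pairWordProd {r : Bool} {a : A} {b : B} {c : A} {s : List A}
    (hs : s ≠ []) (hc : dec r c = (a, b)) :
    Coprod.inl a * (Coprod.inr b * pairWordProd dec false s) = pairWordProd dec r (c :: s) := by
  rw [pairWordProd, List.isEmpty_eq_false_iff.2 hs, branchPos, hc]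
  rfl

/-- The second claim strips a leading letter of `B`, because the preceding pair supplies it. At the
root such a letter is supplied by a pair with first component `1`. -/
theorem pairWordProd_surjective (h : IsPairDecoding dec) (g : Coprod A B) :
    (∃ s, s ≠ [] ∧ pairWordProd dec true s = g) ∧
      ∃ s, s ≠ [] ∧ pairWordProd dec false s = (Coprod.inr (projr g))⁻¹ * g := by
  induction coprodNormal g with
  | one =>
    have h1 : ∀ r, pairWordProd dec r [1] = 1 := fun r => by simp [pairWordProd, branchPos]
    exact ⟨⟨[1], by simp, h1 _⟩, [1], by simp, by simp [h1, projr_one]⟩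
  | left a t ha ht _ ih =>
    have key : ∀ r, ∃ s, s ≠ [] ∧ pairWordProd dec r s = Coprod.inl a * t := by
      intro r
      by_cases hb : projr t = 1
      · rw [eq_one_of_projl_of_projr ht hb]
        exact ⟨[a], by simp, by simp [pairWordProd, branchPos]⟩
      · obtain ⟨s, hs0, hs⟩ := ih.2
        obtain ⟨c, hc⟩ := h.surjective r a (projr t) hb (Or.inr ha)
        refine ⟨c :: s, by simp, ?_⟩
        rw [← inl_mul_inr_mul_pairWordProd hs0 hc, hs, mul_inv_cancel_left]
    rw [projr_inl_mul ha ht, map_one, inv_one, one_mul]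
    exact ⟨key true, key false⟩
  | right b t hb ht _ ih =>
    obtain ⟨s, hs0, hs⟩ := ih.2
    rw [ht, map_one, inv_one, one_mul] at hs
    rw [projr_inr_mul, ht, mul_one, inv_mul_cancel_left]
    refine ⟨?_, s, hs0, hs⟩
    obtain ⟨c, hc⟩ := h.surjective true 1 b hb (Or.inl rfl)
    exact ⟨c :: s, by simp, by rw [← inl_mul_inr_mul_pairWordProd hs0 hc, hs, map_one, one_mul]⟩

theorem projr_prefixProd_mul (h : IsPairDecoding dec) (w : List A) {x : Coprod A B}
    (hx : projr x = 1) : projr (prefixProd dec false w * x) = 1 := by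
  induction w with
  | nil => simpa [prefixProd] using hx
  | cons c w ih =>
    rw [prefixProd, mul_assoc, mul_assoc]
    exact projr_inl_mul (h.fst_ne c) (projl_inr_mul (h.snd_ne _ c) ih)

variable {S : Set A} {T : Set B}

theorem wordNorm_prefixProd_mul (h : IsPairDecoding dec) (hS : Subgroup.closure S = ⊤)
    (hT : Subgroup.closure T = ⊤) (r : Bool) (w : List A) {x : Coprod A B}
    (hx : w = [] ∨ projr x = 1) :
    wordNorm (freeProductGenerators S T) (prefixProd dec r w * x) =
      wordNorm (freeProductGenerators S T) (prefixProd dec r w) +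
        wordNorm (freeProductGenerators S T) x := by
  have key : ∀ r c w x, projr (prefixProd dec false w * x) = 1 →
      wordNorm (freeProductGenerators S T) (prefixProd dec r (c :: w) * x) =
        wordNorm S (dec r c).1 + (wordNorm T (dec r c).2 +
          wordNorm (freeProductGenerators S T) (prefixProd dec false w * x)) := by
    intro r c w x hx
    rw [prefixProd, mul_assoc, mul_assoc,
      wordNorm_inl_mul hS hT _ (projl_inr_mul (h.snd_ne _ c) hx), wordNorm_inr_mul hS hT _ hx]
  rcases hx with rfl | hx
  · simp [prefixProd, wordNorm_one]
  induction w generalizing r with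
  | nil => simp [prefixProd, wordNorm_one]
  | cons c w ih =>
    have h1 := key r c w 1 (h.projr_prefixProd_mul w projr_one)
    rw [mul_one, mul_one] at h1
    rw [key r c w x (h.projr_prefixProd_mul w hx), h1, ih]
    ring

theorem isFloydCoding {f : ℕ → ℝ} (h : IsPairDecoding dec) (hf : IsFloydFunction f) [Finite B]
    (hS : Subgroup.closure S = ⊤) (hSfin : S.Finite) (hT : Subgroup.closure T = ⊤)
    (hdec : ∀ r, ∀ ε > 0, ∀ᶠ c in cofinite, floydEDist f S (dec r c).1 c < ε) :
    IsFloydCoding f S (freeProductGenerators S T) (pairWordProd dec true) := by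
  have hR := closure_freeProductGenerators hS hT
  have hRfin := finite_freeProductGenerators hSfin T.toFinite
  have happ : ∀ w c t, pairWordProd dec true (w ++ c :: t) =
      prefixProd dec true w * pairWordProd dec w.isEmpty (c :: t) := fun w c t => by
    rw [pairWordProd_append, Bool.true_and]
  have hnorm : ∀ w c t, wordNorm (freeProductGenerators S T)
      (prefixProd dec true w * pairWordProd dec w.isEmpty (c :: t)) = _ :=
    fun w c t => h.wordNorm_prefixProd_mul hS hT true w (x := pairWordProd dec w.isEmpty (c :: t)) <| by
      by_cases hw : w = []
      · exact Or.inl hw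
      · rw [List.isEmpty_eq_false_iff.2 hw]
        exact Or.inr (h.projr_pairWordProd _)
  refine isFloydCoding_of_branching hf hS hSfin hR (U := prefixProd dec true)
    (α := fun w c b => branchPos dec w.isEmpty c b) (ι := fun _ a => Coprod.inl a)
    (h.pairWordProd_injective true) (fun g => (h.pairWordProd_surjective g).1) (fun n => ?_)
    (fun w c t => ?_) (fun w c t => ?_) (fun w b ε hε => ?_)
    (fun _ => floydEDist_inl_le hf hS hT) (fun _ a => (wordNorm_inl hS hT a).ge)
    (fun w => ?_) (fun w a => ?_)
  -- A final letter `1` contributes nothing, so every prefix product is the value of a complete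
  -- word.
  · have hinj : Function.Injective (prefixProd dec true) := fun w w' hw => by
      have := h.pairWordProd_injective true (w ++ [1]) (w' ++ [1]) (by simp) (by simp)
        (by rw [happ, happ, hw]; simp [pairWordProd, branchPos])
      simpa using this
    exact (finite_wordNorm_le hR hRfin n).preimage hinj.injOn
  · rw [happ, hnorm, inv_mul_cancel_left]
  · rw [happ, pairWordProd, ← mul_assoc, inv_mul_cancel_left, mul_assoc]
    refine wordNorm_mul_mul_eq hR ?_ ?_
    · have := hnorm w c t
      rwa [pairWordProd] at this
    · rw [wordNorm_inl_mul hS hT _ (h.projl_tail _ c t), wordNorm_inl hS hT]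
  · cases b
    · exact hdec _ ε hε
    · exact Eventually.of_forall fun c => by simpa [branchPos, floydEDist_self] using hε
  · obtain ⟨C, -, hC, hle⟩ := floydEDist_mul_left_le hf hR (prefixProd dec true w)⁻¹
    refine ⟨C, hC, fun c t c' t' => le_trans ?_ (hle _ _)⟩
    rw [happ, happ, inv_mul_cancel_left, inv_mul_cancel_left, ← h.projl_pairWordProd_cons,
      ← h.projl_pairWordProd_cons]
    exact floydEDist_projl_le hf hS hT _ _
  · obtain ⟨C, -, hC, hle⟩ := floydEDist_mul_left_le hf hR (prefixProd dec true w * Coprod.inl a)⁻¹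
    -- Words that diverge at the same position `a` continue with different elements of `B`. As `B`
    -- is finite, these are uniformly separated, and translation followed by `projr` carries the
    -- separation back.
    obtain ⟨η, hη, hlt⟩ := exists_pos_forall_mem_le (Set.finite_univ (α := B))
      (p := fun b η => C * η < ENNReal.ofReal (f (wordNorm T b))) fun b _ =>
        exists_pos_forall_mul_lt hC (ENNReal.ofReal_pos.2 (hf.pos _))
    refine ⟨η, hη, fun c t c' t' hd ha ha' => ?_⟩
    by_contra! hlt'
    have hne : (bif t.isEmpty then 1 else (dec w.isEmpty c).2) ≠
        bif t'.isEmpty then 1 else (dec w.isEmpty c').2 := fun h0 => by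
      obtain ⟨h1, h2⟩ := h.eq_of_branchPos_eq (ha.trans ha'.symm) h0
      exact hd.elim (fun h3 => h3 h1) (fun h3 => h3 h2)
    refine ((le_floydEDist_of_ne hf (S := T) hne).trans ?_).not_gt
      (hlt _ (Set.mem_univ _) _ hlt'.le)
    refine le_trans ?_ (hle _ _)
    have hpr : ∀ c t, branchPos dec w.isEmpty c t.isEmpty = a →
        (prefixProd dec true w * Coprod.inl a)⁻¹ * pairWordProd dec true (w ++ c :: t) =
          bif t.isEmpty then 1 else
            Coprod.inr (dec w.isEmpty c).2 * pairWordProd dec false t := fun c t ha => by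
      rw [happ, pairWordProd, ha, ← mul_assoc (prefixProd dec true w), inv_mul_cancel_left]
    rw [hpr c t ha, hpr c' t' ha', ← h.projr_tail, ← h.projr_tail]
    exact floydEDist_projr_le hf hS hT _ _

end IsPairDecoding

/-- The free product of an infinite group with a non-trivial finite group is coded by words over
the infinite factor. -/
theorem exists_isFloydCoding_finite {f : ℕ → ℝ} (hf : IsFloydFunction f) [Infinite A] [Finite B]
    [Nontrivial B] {S : Set A} {T : Set B} (hS : Subgroup.closure S = ⊤) (hSfin : S.Finite)
    (hT : Subgroup.closure T = ⊤) :
    ∃ Φ, IsFloydCoding f S (freeProductGenerators S T) Φ := by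
  have : Countable A := countable_of_finite_closure_eq_top hS hSfin
  obtain ⟨b₀, hb₀⟩ := exists_ne (1 : B)
  have : Nonempty {b : B // b ≠ 1} := ⟨⟨b₀, hb₀⟩⟩
  have : Infinite {a : A // a ≠ 1} := (Set.finite_singleton (1 : A)).infinite_compl.to_subtype
  -- Finiteness of `B` makes the fibres of the first projection finite. Below, away from the root,
  -- its range misses only `1`.
  obtain ⟨e, he⟩ := exists_equiv_floydEDist_lt hf hS hSfin
    (X := A × {b : B // b ≠ 1}) (p := Prod.fst)
    (Tendsto.cofinite_of_finite_preimage_singleton fun a => by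
      refine ((Set.finite_singleton a).prod (Set.finite_univ (α := {b : B // b ≠ 1}))).subset ?_
      rintro ⟨a', b⟩ h
      simpa using h)
    (by rw [Prod.range_fst]; simp)
  obtain ⟨e', he'⟩ := exists_equiv_floydEDist_lt hf hS hSfin
    (X := {a : A // a ≠ 1} × {b : B // b ≠ 1}) (p := fun x => x.1.1)
    (Tendsto.cofinite_of_finite_preimage_singleton fun a => by
      refine (((Set.finite_singleton a).preimage Subtype.val_injective.injOn).prod
        (Set.finite_univ (α := {b : B // b ≠ 1}))).subset ?_
      rintro ⟨a', b⟩ h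
      simpa using h)
    ((Set.finite_singleton 1).subset fun a ha => by
      by_contra h
      exact ha ⟨(⟨a, h⟩, ⟨b₀, hb₀⟩), rfl⟩)
  let dec : Bool → A → A × B := fun r c =>
    bif r then ((e c).1, (e c).2.1) else ((e' c).1.1, (e' c).2.1)
  have hdec : IsPairDecoding dec := by
    refine ⟨fun c => (e' c).1.2, ?_, ?_, ?_⟩
    · rintro (_ | _) c
      exacts [(e' c).2.2, (e c).2.2]
    · rintro (_ | _) c c' h
      · obtain ⟨h1, h2⟩ := Prod.ext_iff.1 h
        exact e'.injective (Prod.ext (Subtype.ext h1) (Subtype.ext h2))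
      · obtain ⟨h1, h2⟩ := Prod.ext_iff.1 h
        exact e.injective (Prod.ext h1 (Subtype.ext h2))
    · rintro (_ | _) a b hb h
      · exact ⟨e'.symm (⟨a, by simpa using h⟩, ⟨b, hb⟩), by simp [dec]⟩
      · exact ⟨e.symm (a, ⟨b, hb⟩), by simp [dec]⟩
  refine ⟨_, hdec.isFloydCoding hf hS hSfin hT ?_⟩
  rintro (_ | _)
  exacts [he', he]

end FiniteFactor

/-! ### Coding of the free product of two copies of an infinite group. -/

section TwoCopies

open Monoid Filter

variable {A : Type*} [Group A]

/-- The two inclusions of `A` in `A * A`. -/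
def copyIncl : Bool → A →* Coprod A A
  | false => Coprod.inl
  | true => Coprod.inr

/-- The first letter of the normal form if it belongs to the given copy of `A`, and `1`
otherwise. -/
noncomputable def copyProj : Bool → Coprod A A → A
  | false => projl
  | true => projr

theorem copyProj_one (b : Bool) : copyProj b (1 : Coprod A A) = 1 := by
  cases b
  exacts [projl_one, projr_one]

theorem copyProj_copyIncl_mul (b : Bool) (a : A) (g : Coprod A A) :
    copyProj b (copyIncl b a * g) = a * copyProj b g := by
  cases b
  exacts [projl_inl_mul a g, projr_inr_mul a g]

theorem copyProj_not_copyIncl_mul {b : Bool} {a : A} {t : Coprod A A} (ha : a ≠ 1)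
    (ht : copyProj b t = 1) : copyProj (!b) (copyIncl b a * t) = 1 := by
  cases b
  exacts [projr_inl_mul ha ht, projl_inr_mul ha ht]

variable {S : Set A}

theorem wordNorm_copyIncl_mul (hS : Subgroup.closure S = ⊤) {b : Bool} (a : A) {t : Coprod A A}
    (ht : copyProj b t = 1) : wordNorm (freeProductGenerators S S) (copyIncl b a * t) =
      wordNorm S a + wordNorm (freeProductGenerators S S) t := by
  cases b
  exacts [wordNorm_inl_mul hS hS a ht, wordNorm_inr_mul hS hS a ht]

theorem wordNorm_copyIncl (hS : Subgroup.closure S = ⊤) (b : Bool) (a : A) :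
    wordNorm (freeProductGenerators S S) (copyIncl b a) = wordNorm S a := by
  cases b
  exacts [wordNorm_inl hS hS a, wordNorm_inr hS hS a]

theorem floydEDist_copyProj_le {f : ℕ → ℝ} (hf : IsFloydFunction f)
    (hS : Subgroup.closure S = ⊤) (b : Bool) (u v : Coprod A A) :
    floydEDist f S (copyProj b u) (copyProj b v) ≤
      floydEDist f (freeProductGenerators S S) u v := by
  cases b
  exacts [floydEDist_projl_le hf hS hS u v, floydEDist_projr_le hf hS hS u v]

theorem floydEDist_copyIncl_le {f : ℕ → ℝ} (hf : IsFloydFunction f)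
    (hS : Subgroup.closure S = ⊤) (b : Bool) (a a' : A) :
    floydEDist f (freeProductGenerators S S) (copyIncl b a) (copyIncl b a') ≤
      floydEDist f S a a' := by
  cases b
  exacts [floydEDist_inl_le hf hS hS a a', floydEDist_inr_le hf hS hS a a']

/-- The copy of `A` to which the letter after the word `w` belongs. -/
def copyAfter : Bool → List A → Bool
  | b, [] => b
  | b, _ :: w => copyAfter (!b) w

/-- The element of `A * A` that a word over `A` encodes, where the decoded letters lie in
alternating copies. The first flag tells whether the first letter is at the root, the second one
is the copy of the first letter. -/
def altWordProd (dec : Bool → A → A) : Bool → Bool → List A → Coprod A A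
  | _, _, [] => 1
  | r, b, c :: t => copyIncl b (dec r c) * altWordProd dec false (!b) t

/-- A decoding of letters in `A` as non-trivial elements of `A`, except at the root, where letters
stand for themselves. -/
structure IsAltDecoding (dec : Bool → A → A) : Prop where
  ne_one : ∀ c, dec false c ≠ 1
  injective : Function.Injective (dec false)
  surjective : ∀ a, a ≠ 1 → ∃ c, dec false c = a
  root : ∀ c, dec true c = c

variable {dec : Bool → A → A}

theorem altWordProd_append (w t : List A) (r b : Bool) :
    altWordProd dec r b (w ++ t) =
      altWordProd dec r b w * altWordProd dec (r && w.isEmpty) (copyAfter b w) t := by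
  induction w generalizing r b with
  | nil => simp [altWordProd, copyAfter]
  | cons d w ih => simp [altWordProd, copyAfter, ih, mul_assoc]

namespace IsAltDecoding

theorem injective' (h : IsAltDecoding dec) (r : Bool) : Function.Injective (dec r) := by
  cases r
  · exact h.injective
  · intro c c' hc
    rwa [h.root, h.root] at hc

theorem copyProj_altWordProd (h : IsAltDecoding dec) (b : Bool) (t : List A) :
    copyProj b (altWordProd dec false (!b) t) = 1 := by
  induction t generalizing b with
  | nil => exact copyProj_one b
  | cons c t ih =>
    have := copyProj_not_copyIncl_mul (b := !b) (h.ne_one c) (ih (!b))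
    rw [altWordProd]
    rwa [Bool.not_not] at this ⊢

theorem copyProj_altWordProd_cons (h : IsAltDecoding dec) (r b : Bool) (c : A) (t : List A) :
    copyProj b (altWordProd dec r b (c :: t)) = dec r c := by
  rw [altWordProd, copyProj_copyIncl_mul, h.copyProj_altWordProd, mul_one]

/-- At the root `[]` and `[1]` both give the identity, so the empty word must be excluded there;
away from the root letters are non-trivial and it need not be. -/
theorem altWordProd_injective (h : IsAltDecoding dec) : ∀ (r b : Bool) (l l' : List A),
    (r = true → l ≠ [] ∧ l' ≠ []) → altWordProd dec r b l = altWordProd dec r b l' → l = l'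
  | _, _, [], [], _, _ => rfl
  | r, b, [], c :: t, hr, heq => by
    cases r
    · have := congrArg (copyProj b) heq
      rw [h.copyProj_altWordProd_cons, altWordProd, copyProj_one] at this
      exact absurd this.symm (h.ne_one c)
    · exact absurd rfl (hr rfl).1
  | r, b, c :: t, [], hr, heq => by
    cases r
    · have := congrArg (copyProj b) heq
      rw [h.copyProj_altWordProd_cons, altWordProd, copyProj_one] at this
      exact absurd this (h.ne_one c)
    · exact absurd rfl (hr rfl).2
  | r, b, c :: t, c' :: t', _, heq => by
    have hc := congrArg (copyProj b) heq
    rw [h.copyProj_altWordProd_cons, h.copyProj_altWordProd_cons] at hc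
    obtain rfl := h.injective' r hc
    rw [altWordProd, altWordProd, mul_right_inj] at heq
    rw [h.altWordProd_injective false (!b) t t' (by simp) heq]

theorem exists_altWordProd_eq (h : IsAltDecoding dec) (g : Coprod A A) :
    ∀ b, copyProj b g = 1 → ∃ t, altWordProd dec false (!b) t = g := by
  have step : ∀ b a t, a ≠ 1 → copyProj b t = 1 →
      (∀ b, copyProj b t = 1 → ∃ s, altWordProd dec false (!b) s = t) →
      ∀ b', copyProj b' (copyIncl b a * t) = 1 →
        ∃ s, altWordProd dec false (!b') s = copyIncl b a * t := by
    intro b a t ha ht ih b' hb'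
    have hbb : b' = !b := by
      refine Bool.eq_not_of_ne ?_
      rintro rfl
      rw [copyProj_copyIncl_mul, ht, mul_one] at hb'
      exact ha hb'
    obtain ⟨s, hs⟩ := ih b ht
    obtain ⟨c, hc⟩ := h.surjective a ha
    exact ⟨c :: s, by rw [hbb, Bool.not_not, altWordProd, hc, hs]⟩
  induction coprodNormal g with
  | one => exact fun b _ => ⟨[], rfl⟩
  | left a t ha ht _ ih => exact step false a t ha ht ih
  | right a t ha ht _ ih => exact step true a t ha ht ih

theorem altWordProd_surjective (h : IsAltDecoding dec) (g : Coprod A A) :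
    ∃ l, l ≠ [] ∧ altWordProd dec true false l = g := by
  obtain ⟨t, ht⟩ := h.exists_altWordProd_eq ((Coprod.inl (projl g))⁻¹ * g) false (by
    change projl _ = 1
    rw [← map_inv, projl_inl_mul, inv_mul_cancel])
  refine ⟨projl g :: t, by simp, ?_⟩
  rw [altWordProd, ht, h.root]
  exact mul_inv_cancel_left _ _

theorem wordNorm_altWordProd_append (h : IsAltDecoding dec) (hS : Subgroup.closure S = ⊤)
    (r b : Bool) (w t : List A) :
    wordNorm (freeProductGenerators S S) (altWordProd dec r b (w ++ t)) =
      wordNorm (freeProductGenerators S S) (altWordProd dec r b w) +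
        wordNorm (freeProductGenerators S S)
          (altWordProd dec (r && w.isEmpty) (copyAfter b w) t) := by
  induction w generalizing r b with
  | nil => simp [altWordProd, copyAfter, wordNorm_one]
  | cons c w ih =>
    rw [List.cons_append, altWordProd, altWordProd,
      wordNorm_copyIncl_mul hS _ (h.copyProj_altWordProd b _),
      wordNorm_copyIncl_mul hS _ (h.copyProj_altWordProd b _), ih, add_assoc]
    simp [copyAfter]

theorem isFloydCoding {f : ℕ → ℝ} (h : IsAltDecoding dec) (hf : IsFloydFunction f)
    (hS : Subgroup.closure S = ⊤) (hSfin : S.Finite)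
    (hdec : ∀ r, ∀ ε > 0, ∀ᶠ c in cofinite, floydEDist f S (dec r c) c < ε) :
    IsFloydCoding f S (freeProductGenerators S S) (altWordProd dec true false) := by
  have hR := closure_freeProductGenerators hS hS
  have hRfin := finite_freeProductGenerators hSfin hSfin
  set Φ := altWordProd dec true false
  have happ : ∀ w c t, Φ (w ++ c :: t) =
      Φ w * altWordProd dec w.isEmpty (copyAfter false w) (c :: t) := fun w c t => by
    simp only [Φ, altWordProd_append, Bool.true_and]
  have hnorm : ∀ w c t, wordNorm (freeProductGenerators S S) (Φ (w ++ c :: t)) =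
      wordNorm (freeProductGenerators S S) (Φ w) + wordNorm (freeProductGenerators S S)
        (altWordProd dec w.isEmpty (copyAfter false w) (c :: t)) := fun w c t => by
    simp only [Φ, h.wordNorm_altWordProd_append hS, Bool.true_and]
  have hinj : ∀ l l', l ≠ [] → l' ≠ [] → Φ l = Φ l' → l = l' := fun l l' hl hl' heq =>
    h.altWordProd_injective true false l l' (fun _ => ⟨hl, hl'⟩) heq
  refine isFloydCoding_of_branching hf hS hSfin hR (U := Φ)
    (α := fun w c _ => dec w.isEmpty c) (ι := fun w a => copyIncl (copyAfter false w) a)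
    hinj h.altWordProd_surjective (fun n => ?_)
    (fun w c t => ?_) (fun w c t => ?_) (fun w _ => hdec w.isEmpty)
    (fun w => floydEDist_copyIncl_le hf hS _) (fun w a => (wordNorm_copyIncl hS _ a).ge)
    (fun w => ?_) (fun w a => ?_)
  · have : (Φ ⁻¹' {g | wordNorm (freeProductGenerators S S) g ≤ n} ∩ {l | l ≠ []}).Finite := by
      refine Set.Finite.of_finite_image ((finite_wordNorm_le hR hRfin n).subset ?_)
        (fun l hl l' hl' => hinj l l' hl.2 hl'.2)
      rintro _ ⟨l, hl, rfl⟩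
      exact hl.1
    refine (this.union (Set.finite_singleton [])).subset fun l hl => ?_
    by_cases h0 : l = []
    · exact Or.inr h0
    · exact Or.inl ⟨hl, h0⟩
  · rw [hnorm, happ, inv_mul_cancel_left]
  · have h1 := hnorm w c t
    rw [happ, altWordProd] at h1 ⊢
    rw [← mul_assoc, inv_mul_cancel_left, mul_assoc]
    refine wordNorm_mul_mul_eq hR h1 ?_
    rw [wordNorm_copyIncl_mul hS _ (h.copyProj_altWordProd _ _), wordNorm_copyIncl hS]
  · obtain ⟨C, -, hC, hle⟩ := floydEDist_mul_left_le hf hR (Φ w)⁻¹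
    refine ⟨C, hC, fun c t c' t' => le_trans ?_ (hle _ _)⟩
    rw [happ, happ, inv_mul_cancel_left, inv_mul_cancel_left,
      ← h.copyProj_altWordProd_cons _ (copyAfter false w) c t,
      ← h.copyProj_altWordProd_cons _ (copyAfter false w) c' t']
    exact floydEDist_copyProj_le hf hS _ _ _
  -- Decoding is injective, so equal positions mean equal letters, and exactly one of the words ends
  -- there. That word gives the single vertex `Φ (w ++ [c₀])`, whose isolation radius is the
  -- required bound.
  · by_cases hex : ∃ c, dec w.isEmpty c = a
    · obtain ⟨c₀, hc₀⟩ := hex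
      have key : ∀ c t, dec w.isEmpty c = a → t ≠ [] →
          ENNReal.ofReal (f (wordNorm (freeProductGenerators S S) (Φ (w ++ [c₀])))) ≤
            floydEDist f (freeProductGenerators S S) (Φ (w ++ [c₀])) (Φ (w ++ c :: t)) := by
        intro c t _ ht
        refine le_floydEDist_of_ne hf fun h0 => ht ?_
        have := hinj _ _ (by simp) (by simp) h0
        simp at this
        exact this.2
      refine ⟨_, ENNReal.ofReal_pos.2 (hf.pos
        (wordNorm (freeProductGenerators S S) (Φ (w ++ [c₀])))), fun c t c' t' hd ha ha' => ?_⟩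
      obtain rfl : c = c' := h.injective' _ (ha.trans ha'.symm)
      obtain rfl : c = c₀ := h.injective' _ (ha.trans hc₀.symm)
      have hd := hd.resolve_left (fun h0 => h0 rfl)
      by_cases ht : t = []
      · subst ht
        exact key c t' ha' fun h0 => hd (by simp [h0])
      · have ht' : t' = [] := by
          by_contra h0
          exact hd (by simp [ht, h0])
        subst ht'
        rw [floydEDist_comm]
        exact key c t ha ht
    · exact ⟨1, one_pos, fun c t c' t' _ ha _ => absurd ⟨c, ha⟩ hex⟩

end IsAltDecoding

/-- The free product of two copies of an infinite group is coded by words over the group. -/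
theorem exists_isFloydCoding_copies {f : ℕ → ℝ} (hf : IsFloydFunction f) [Infinite A]
    (hS : Subgroup.closure S = ⊤) (hSfin : S.Finite) :
    ∃ Φ, IsFloydCoding f S (freeProductGenerators S S) Φ := by
  have : Countable A := countable_of_finite_closure_eq_top hS hSfin
  have : Infinite {a : A // a ≠ 1} := (Set.finite_singleton (1 : A)).infinite_compl.to_subtype
  obtain ⟨e, he⟩ := exists_equiv_floydEDist_lt hf hS hSfin
    (X := {a : A // a ≠ 1}) (p := Subtype.val) Subtype.val_injective.tendsto_cofinite
    ((Set.finite_singleton 1).subset fun a ha => by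
      by_contra h
      exact ha ⟨⟨a, h⟩, rfl⟩)
  have hdec : IsAltDecoding (fun r c => bif r then c else (e c : A)) :=
    ⟨fun c => (e c).2, Subtype.val_injective.comp e.injective,
      fun a ha => ⟨e.symm ⟨a, ha⟩, by simp⟩, fun _ => rfl⟩
  refine ⟨_, hdec.isFloydCoding hf hS hSfin ?_⟩
  rintro (_ | _)
  · exact he
  · exact fun ε hε => Eventually.of_forall fun c => by simpa [floydEDist_self] using hε

end TwoCopies

theorem proposition4p10 {A F : Type*} [Group A] [Infinite A] [Group.FG A]
    [Group F] [Finite F] [Nontrivial F] (f : ℕ → ℝ) (hf : IsFloydFunction f) :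
    (∀ (S : Set A) (T : Set F), S.Finite → Subgroup.closure S = ⊤ → Subgroup.closure T = ⊤ →
      Nonempty (floydBoundary f (freeProductGenerators S S) ≃ₜ
        floydBoundary f (freeProductGenerators S T))) ∧
    ((∃ D : ℝ, ∀ n, 1 ≤ n → f n ≤ D * f (2 * n)) →
      ∀ (P : Set (Monoid.Coprod A A)) (Q : Set (Monoid.Coprod A F)),
        P.Finite → Q.Finite → Subgroup.closure P = ⊤ → Subgroup.closure Q = ⊤ →
        Nonempty (floydBoundary f P ≃ₜ floydBoundary f Q)) := by
  have main : ∀ (S : Set A) (T : Set F), S.Finite → Subgroup.closure S = ⊤ →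
      Subgroup.closure T = ⊤ → Nonempty (floydBoundary f (freeProductGenerators S S) ≃ₜ
        floydBoundary f (freeProductGenerators S T)) := by
    intro S T hSfin hS hT
    obtain ⟨Φ, hΦ⟩ := exists_isFloydCoding_copies hf hS hSfin
    obtain ⟨Ψ, hΨ⟩ := exists_isFloydCoding_finite hf hS hSfin hT
    exact hΦ.nonempty_homeomorph hΨ
  refine ⟨main, fun hD P Q hPfin hQfin hP hQ => ?_⟩
  obtain ⟨S, hS, hSfin⟩ := Group.fg_iff.1 (inferInstance : Group.FG A)
  have hT : Subgroup.closure (Set.univ : Set F) = ⊤ := Subgroup.closure_univ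
  obtain ⟨e₁⟩ := nonempty_floydBoundary_homeomorph_of_doubling hf hD hP hPfin
    (closure_freeProductGenerators hS hS) (finite_freeProductGenerators hSfin hSfin)
  obtain ⟨e₂⟩ := main S Set.univ hSfin hS hT
  obtain ⟨e₃⟩ := nonempty_floydBoundary_homeomorph_of_doubling hf hD
    (closure_freeProductGenerators hS hT) (finite_freeProductGenerators hSfin Set.finite_univ)
    hQ hQfin
  exact ⟨(e₁.trans e₂).trans e₃⟩
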